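/- Let $d\ge1$ be an integer, $d_\sharp=\left[\frac{d-1}{2}\right]+1$, and identify $\mathbb{T}^d=\mathbb{R}^d/\mathbb{Z}^d$ with $(-1/2,1/2]^d\subset\mathbb{R}^d$. For an integrable $F:\mathbb{R}^d\to\mathbb{C}$ put $\hat F(\xi)=\int_{\mathbb{R}^d}F(x)e^{-2\pi i\xi x}\,dx$ and $\sigma_\lambda(F)(x)=\int_{|\xi|<\lambda}\hat F(\xi)e^{2\pi i\xi x}\,d\xi$; for an integrable $f:\mathbb{T}^d\to\mathbb{C}$ put $\hat f(m)=\int_{\mathbb{T}^d}f(x)e^{-2\pi imx}\,dx$ $(m\in\mathbb{Z}^d)$ and $S_\lambda(f)(x)=\sum_{|m|<\lambda}\hat f(m)e^{2\pi imx}$. The periodization of $F$ is $f(x)=\sum_{m\in\mathbb{Z}^d}F(x+m)$, $x\in\mathbb{T}^d$. For $\alpha>-1$, $s\ge0$ and $x\in\mathbb{R}^d$ let $$D_\alpha(s:x)=\frac1{\Gamma(\alpha+1)}\sum_{|m|^2<s}(s-|m|^2)^\alpha e^{2\pi imx},\qquad \mathcal{D}_\alpha(s:x)=\frac1{\Gamma(\alpha+1)}\int_{|\xi|^2<s}(s-|\xi|^2)^\alpha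 e^{2\pi ix\xi}\,d\xi$$ (both equal to $0$ for $s=0$), and $\Delta_\alpha(s:x)=D_\alpha(s:x)-\mathcal{D}_\alpha(s:x)$. With $J_\nu$ the Bessel function of the first kind of order $\nu>-1$, let $\Lambda_\nu(t:s)=J_\nu(2\pi t\sqrt s)/s^{\nu/2}$ for $t>0$, $s>0$ and $\Lambda_\nu(t:0)=(\pi t)^\nu/\Gamma(\nu+1)$. For a function $\phi:[0,\infty)\to\mathbb{C}$ let $F_\phi(x)=\phi(|x|)$, $x\in\mathbb{R}^d$, let $f_\phi$ be the periodization of $F_\phi$, and let $$A_\phi(s)=2\pi\int_0^\infty\phi(t)\,\Lambda_{\frac d2-1}(t:s)\,t^{\frac d2}\,dt,\qquad s\ge0.$$ **Theorem.** Let $\phi$ be a function on $[0,\infty)$ with compact support such that $F_\phi$ is integrable on $\mathbb{R}^d$. Then $f_\phi$ is integrable on $\mathbb{T}^d$, $A_\phi$ is infinitely differentiable on $[0,\infty)$ (with one-sided derivatives at $0$), and for all $\lambda\ge0$ and all $x\in\mathbb{T}^d$ $$S_\lambda(f_\phi)(x)=\sigma_\lambda(F_\phi)(x)+\sum_{j=0}^{d_\sharp}(-1)^j\Delta_j(\lambda^2:x)A_\phi^{(j)}(\lambda^2)+(-1)^{d_\sharp+1}\sum_{m\in\mathbb{Z}^d\setminus\{0\}}\int_0^{\lambda^2}\mathcal{D}_{d_\sharp}(s:x-m)A_\phi^{(d_\sharp+1)}(s)\,ds,$$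 where the integrals exist and the series over $m$ converges absolutely. **Corollary.** Let $\beta>-1$ and $a>0$, let $\phi_{\beta,a}(t)=(a^2-t^2)^\beta$ for $0\le t<a$ and $\phi_{\beta,a}(t)=0$ for $t\ge a$, let $U_{\beta,a}(x)=\phi_{\beta,a}(|x|)$, $x\in\mathbb{R}^d$, let $u_{\beta,a}$ be the periodization of $U_{\beta,a}$, and write $A_{\beta,a}=A_{\phi_{\beta,a}}$. Then $U_{\beta,a}$ is integrable on $\mathbb{R}^d$, $u_{\beta,a}$ is integrable on $\mathbb{T}^d$, $A_{\beta,a}$ is infinitely differentiable on $[0,\infty)$, and for all $\lambda\ge0$ and all $x\in\mathbb{T}^d$ $$S_\lambda(u_{\beta,a})(x)=\sigma_\lambda(U_{\beta,a})(x)+\sum_{j=0}^{d_\sharp}(-1)^j\Delta_j(\lambda^2:x)A_{\beta,a}^{(j)}(\lambda^2)+(-1)^{d_\sharp+1}\sum_{m\in\mathbb{Z}^d\setminus\{0\}}\int_0^{\lambda^2}\mathcal{D}_{d_\sharp}(s:x-m)A_{\beta,a}^{(d_\sharp+1)}(s)\,ds,$$ where again the integrals exist and the series over $m$ converges absolutely.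 -/

import Mathlib

open MeasureTheory Set
open scoped NNReal FourierTransform ContDiff

noncomputable section

namespace LatticeFourier

/-- `ℝ^d` with the Euclidean norm. -/
abbrev E (d : ℕ) := EuclideanSpace ℝ (Fin d)

/-- The lattice point `m ∈ ℤ^d`, viewed in `ℝ^d`. -/
def latt {d : ℕ} (m : Fin d → ℤ) : E d := WithLp.toLp 2 (fun i => (m i : ℝ))

theorem finite_norm_lt (d : ℕ) (r : ℝ) : {m : Fin d → ℤ | ‖latt m‖ < r}.Finite := by
  refine (Set.finite_Icc (fun _ : Fin d => -⌈r⌉) (fun _ => ⌈r⌉)).subset ?_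
  intro m hm
  have key : ∀ i, |(m i : ℝ)| ≤ (⌈r⌉ : ℝ) := by
    intro i
    have h := PiLp.norm_apply_le (latt m) i
    simp only [latt, Real.norm_eq_abs] at h
    exact h.trans ((le_of_lt hm).trans (Int.le_ceil r))
  refine ⟨fun i => ?_, fun i => ?_⟩
  · have h := (abs_le.mp (key i)).1
    exact_mod_cast h
  · have h := (abs_le.mp (key i)).2
    exact_mod_cast h

theorem finite_norm_sq_lt (d : ℕ) (s : ℝ) : {m : Fin d → ℤ | ‖latt m‖ ^ 2 < s}.Finite := by
  refine (finite_norm_lt d (Real.sqrt s)).subset ?_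
  intro m hm
  exact Real.lt_sqrt_of_sq_lt hm

/-- The character `e^{2πi⟨ξ,x⟩}`. -/
def e {d : ℕ} (ξ x : E d) : ℂ :=
  Complex.exp (2 * (Real.pi : ℂ) * Complex.I * ((inner ℝ ξ x : ℝ) : ℂ))

/-- The torus `𝕋^d`, identified with `(-1/2, 1/2]^d ⊆ ℝ^d`. -/
def torus (d : ℕ) : Set (E d) := {x | ∀ i, x i ∈ Ioc (-(1 / 2) : ℝ) (1 / 2)}

/-- The spherical partial Fourier integral `σ_r(F)(x) = ∫_{|ξ|<r} F̂(ξ) e^{2πiξx} dξ`;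
`𝓕 F ξ = ∫ F(x) e^{-2πi⟨x,ξ⟩} dx`. -/
def sphericalIntegral {d : ℕ} (r : ℝ) (F : E d → ℂ) (x : E d) : ℂ :=
  ∫ ξ in {ξ : E d | ‖ξ‖ < r}, 𝓕 F ξ * e ξ x

/-- The Fourier coefficient `f̂(m) = ∫_{𝕋^d} f(x) e^{-2πimx} dx`. -/
def fourierCoefficient {d : ℕ} (f : E d → ℂ) (m : Fin d → ℤ) : ℂ :=
  ∫ x in torus d, f x * e (-latt m) x

/-- The spherical partial sum `S_r(f)(x) = ∑_{|m|<r} f̂(m) e^{2πimx}`. -/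
def sphericalSum {d : ℕ} (r : ℝ) (f : E d → ℂ) (x : E d) : ℂ :=
  ∑ m ∈ (finite_norm_lt d r).toFinset, fourierCoefficient f m * e (latt m) x

/-- The periodization `f(x) = ∑_{m ∈ ℤ^d} F(x + m)`. For `F` of bounded support, which is the
only case used, every such sum has finitely many nonzero terms. -/
def periodization {d : ℕ} (F : E d → ℂ) (x : E d) : ℂ :=
  ∑' m : Fin d → ℤ, F (x + latt m)

/-- The radial function `F_φ(x) = φ(|x|)` on `ℝ^d`. -/
def radial (d : ℕ) (φ : ℝ≥0 → ℂ) (x : E d) : ℂ := φ ‖x‖₊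

/-- The Bessel function of the first kind `J_ν(s)`, for `ν > -1` and `s > 0`. -/
def besselJ (ν s : ℝ) : ℝ :=
  ∑' k : ℕ, (-1) ^ k / ((Nat.factorial k : ℝ) * Real.Gamma (ν + k + 1)) *
    (s / 2) ^ (2 * (k : ℝ) + ν)

/-- `Λ_ν(t:s) = J_ν(2πt√s) / s^{ν/2}` for `s > 0`, and `Λ_ν(t:0) = (πt)^ν / Γ(ν+1)`. -/
def Lam (ν t s : ℝ) : ℝ :=
  if s = 0 then (Real.pi * t) ^ ν / Real.Gamma (ν + 1)
  else besselJ ν (2 * Real.pi * t * Real.sqrt s) / s ^ (ν / 2)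

/-- `A_φ(s) = 2π ∫_0^∞ φ(t) Λ_{d/2-1}(t:s) t^{d/2} dt`, for `s ≥ 0`. -/
def A (d : ℕ) (φ : ℝ≥0 → ℂ) (s : ℝ) : ℂ :=
  2 * (Real.pi : ℂ) * ∫ t in Ioi (0 : ℝ),
    φ t.toNNReal * ((Lam ((d : ℝ) / 2 - 1) t s * t ^ ((d : ℝ) / 2) : ℝ) : ℂ)

/-- The derivative `A_φ^{(j)}(s)` of `A_φ` as a function on `[0,∞)` (one-sided at `s = 0`). -/
def Aderiv (d : ℕ) (φ : ℝ≥0 → ℂ) (j : ℕ) (s : ℝ) : ℂ :=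
  iteratedDerivWithin j (A d φ) (Ici 0) s

/-- The lattice Riesz mean
`D_α(s:x) = Γ(α+1)⁻¹ ∑_{|m|²<s} (s-|m|²)^α e^{2πimx}` (the empty sum for `s = 0`). -/
def Dsum {d : ℕ} (α s : ℝ) (x : E d) : ℂ :=
  ((Real.Gamma (α + 1) : ℝ) : ℂ)⁻¹ *
    ∑ m ∈ (finite_norm_sq_lt d s).toFinset,
      (((s - ‖latt m‖ ^ 2) ^ α : ℝ) : ℂ) * e (latt m) x

/-- Its continuous analogue
`𝒟_α(s:x) = Γ(α+1)⁻¹ ∫_{|ξ|²<s} (s-|ξ|²)^α e^{2πixξ} dξ` (zero for `s = 0`). -/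
def Dint {d : ℕ} (α s : ℝ) (x : E d) : ℂ :=
  ((Real.Gamma (α + 1) : ℝ) : ℂ)⁻¹ *
    ∫ ξ in {ξ : E d | ‖ξ‖ ^ 2 < s}, (((s - ‖ξ‖ ^ 2) ^ α : ℝ) : ℂ) * e ξ x

/-- The discrepancy `Δ_α(s:x) = D_α(s:x) - 𝒟_α(s:x)`. -/
def Delta {d : ℕ} (α s : ℝ) (x : E d) : ℂ := Dsum α s x - Dint α s x

/-- `d♯ = [(d-1)/2] + 1`, the smallest integer greater than `(d-1)/2` (for `d ≥ 1`). -/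
def dSharp (d : ℕ) : ℕ := (d - 1) / 2 + 1

/-- `φ_{β,a}(t) = (a²-t²)^β` for `0 ≤ t < a`, and `0` for `t ≥ a`. -/
def phiBeta (β a : ℝ) (t : ℝ≥0) : ℂ :=
  if (t : ℝ) < a then (((a ^ 2 - (t : ℝ) ^ 2) ^ β : ℝ) : ℂ) else 0

/-- `U_{β,a}(x) = (a²-|x|²)^β` for `|x| < a`, and `0` for `|x| ≥ a`. -/
def U (d : ℕ) (β a : ℝ) (x : E d) : ℂ :=
  if ‖x‖ < a then (((a ^ 2 - ‖x‖ ^ 2) ^ β : ℝ) : ℂ) else 0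

/-- `u_{β,a}`, the periodization of `U_{β,a}`. -/
def u (d : ℕ) (β a : ℝ) : E d → ℂ := periodization (U d β a)

end LatticeFourier

end

open LatticeFourier

noncomputable section

namespace LatticeFourier

/-! By polar coordinates the Fourier transform of a radial function depends on `|ξ|²` alone:
`F̂_φ(ξ) = A_φ(|ξ|²)` (`fourier_radial`). Compact support makes `A_φ` the restriction of a function
`a` smooth on the whole line (`hasDerivAt_Aext`), and unfolding the periodization gives `f̂_φ(m) =
F̂_φ(m)`. So `S_λ` is the sum of `a(|m|²) e^{2πimx}` over `|m|² < L = λ²`, and `σ_λ` is the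
corresponding integral over the ball.

Expand `a` by Taylor's formula at `L` to order `k + 1`, where `k = d♯`. Summation over lattice
points (`sum_lattice_taylor`) turns the truncated powers into `D_j`; integration over the ball
(`integral_ball_taylor`) turns them into `𝒟_j`. Subtracting leaves `(-1)^j Δ_j(L) a^{(j)}(L)` for `j
≤ k + 1` and a remainder `∫ Δ_{k+1} a^{(k+2)}`.

Poisson summation (`hasSum_Dint`) writes `Δ_{k+1}(s:x)` as the sum of `𝒟_{k+1}(s:x-m)` over `m ≠ 0`.
It needs absolute convergence, which comes from the decay `|y|^{-(d/2+k+1)}` of `𝒟_{k+1}(s:y)`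
(`exists_Dint_decay`) and `d/2 + k + 1 > d`. Since `𝒟_{k+1}' = 𝒟_k` in `s`, integrating each term by
parts lowers the order to `k`, and the boundary terms add up to `Δ_{k+1}(L) a^{(k+1)}(L)`, which
absorbs the surplus Taylor term `j = k + 1` (`hasSum_integral_Dint_mul`). The detour through order
`k + 1` is needed because at order `k` the decay is not summable when `d` is even. -/

/-! ### Bessel functions: power series, recurrence, and a bound on the half-line. -/

/-- The entire function `∑ (-1)^j u^j / (j! Γ(ν+j+1))`, so that `J_ν(2√u) = u^{ν/2} bess ν u`. -/
def bess (ν u : ℝ) : ℝ :=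
  ∑' j : ℕ, (-1) ^ j / ((Nat.factorial j : ℝ) * Real.Gamma (ν + j + 1)) * u ^ j

/-- `Γ(z+1) = zΓ(z)` does not decrease once `z ≥ 1`, which holds from `j = 1` on. Only the step from
`j = 0` may decrease, hence a minimum of two values. -/
theorem exists_lower_bound_Gamma {ν : ℝ} (hν : -1 < ν) :
    ∃ c > 0, ∀ j : ℕ, c ≤ Real.Gamma (ν + j + 1) := by
  refine ⟨min (Real.Gamma (ν + 1)) (Real.Gamma (ν + 2)),
    lt_min (Real.Gamma_pos_of_pos (by linarith)) (Real.Gamma_pos_of_pos (by linarith)), ?_⟩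
  intro j
  induction j with
  | zero => simp
  | succ j ih =>
    rcases Nat.eq_zero_or_pos j with rfl | hj
    · refine (min_le_right _ _).trans (le_of_eq ?_)
      congr 1; push_cast; ring
    · have hj' : (1 : ℝ) ≤ j := by exact_mod_cast hj
      have h : Real.Gamma (ν + (j + 1 : ℕ) + 1) = (ν + j + 1) * Real.Gamma (ν + j + 1) := by
        rw [← Real.Gamma_add_one (by linarith)]; congr 1; push_cast; ring
      rw [h]
      have hG : 0 < Real.Gamma (ν + j + 1) := Real.Gamma_pos_of_pos (by linarith)
      nlinarith

theorem exists_bess_coeff_bound {ν : ℝ} (hν : -1 < ν) :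
    ∃ C > 0, ∀ j : ℕ, |(-1) ^ j / ((Nat.factorial j : ℝ) * Real.Gamma (ν + j + 1))|
      ≤ C / (Nat.factorial j : ℝ) := by
  obtain ⟨c, hc, h⟩ := exists_lower_bound_Gamma hν
  refine ⟨c⁻¹, by positivity, fun j => ?_⟩
  have hf : (0 : ℝ) < Nat.factorial j := by positivity
  have hG : 0 < Real.Gamma (ν + j + 1) := hc.trans_le (h j)
  rw [abs_div, abs_pow, abs_neg, abs_one, one_pow, abs_of_pos (by positivity), div_eq_mul_inv,
    one_mul, mul_inv, mul_comm, div_eq_mul_inv]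
  gcongr
  exact h j

theorem summable_bess {ν : ℝ} (hν : -1 < ν) (u : ℝ) :
    Summable fun j : ℕ =>
      (-1) ^ j / ((Nat.factorial j : ℝ) * Real.Gamma (ν + j + 1)) * u ^ j := by
  obtain ⟨C, hC, h⟩ := exists_bess_coeff_bound hν
  refine Summable.of_norm_bounded ((Real.summable_pow_div_factorial |u|).mul_left C) fun j => ?_
  rw [Real.norm_eq_abs, abs_mul, abs_pow]
  calc _ ≤ C / (Nat.factorial j : ℝ) * |u| ^ j := by gcongr; exact h j
    _ = _ := by ring

theorem bess_zero (ν : ℝ) : bess ν 0 = (Real.Gamma (ν + 1))⁻¹ := by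
  rw [bess, tsum_eq_single 0]
  · simp
  · intro j hj; simp [hj]

theorem bess_coeff_succ_mul (ν : ℝ) (j : ℕ) :
    (-1) ^ (j + 1) / ((Nat.factorial (j + 1) : ℝ) * Real.Gamma (ν + (j + 1 : ℕ) + 1)) * (j + 1)
      = -((-1) ^ j / ((Nat.factorial j : ℝ) * Real.Gamma (ν + 1 + j + 1))) := by
  have : ν + (j + 1 : ℕ) + 1 = ν + 1 + j + 1 := by push_cast; ring
  rw [this, Nat.factorial_succ]
  have hf : (Nat.factorial j : ℝ) ≠ 0 := by positivity
  have hj : (j : ℝ) + 1 ≠ 0 := by positivity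
  push_cast
  by_cases hG : Real.Gamma (ν + 1 + j + 1) = 0
  · simp [hG]
  · field_simp; ring

/-- Termwise differentiation on a ball of radius `|u| + 1`, where the differentiated series is
dominated by an exponential series. The index shift raises the order by one and flips the sign. -/
theorem hasDerivAt_bess {ν : ℝ} (hν : -1 < ν) (u : ℝ) :
    HasDerivAt (bess ν) (-bess (ν + 1) u) u := by
  obtain ⟨C', hC', h'⟩ := exists_bess_coeff_bound (show -1 < ν + 1 by linarith)
  set c : ℕ → ℝ := fun j => (-1) ^ j / ((Nat.factorial j : ℝ) * Real.Gamma (ν + j + 1)) with hc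
  set c' : ℕ → ℝ := fun j =>
    (-1) ^ j / ((Nat.factorial j : ℝ) * Real.Gamma (ν + 1 + j + 1)) with hc'
  have hrel : ∀ j, c (j + 1) * (j + 1) = - c' j := fun j => bess_coeff_succ_mul ν j
  set R := |u| + 1 with hR
  have hR0 : 0 ≤ R := by positivity
  have key := hasDerivAt_tsum_of_isPreconnected (𝕜 := ℝ) (F := ℝ)
    (u := fun j : ℕ => |c j| * (j * R ^ (j - 1)))
    (g := fun j z => c j * z ^ j) (g' := fun j z => c j * (j * z ^ (j - 1)))
    (t := Metric.ball 0 R) (y₀ := u) (y := u) ?_ Metric.isOpen_ball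
    (convex_ball _ _).isPreconnected ?_ ?_ (by simp [hR]) (summable_bess hν u) (by simp [hR])
  · have e : ∑' j : ℕ, c j * (j * u ^ (j - 1)) = -bess (ν + 1) u := by
      set f : ℕ → ℝ := fun j => c j * (j * u ^ (j - 1)) with hf
      have hfs : ∀ j, f (j + 1) = -(c' j * u ^ j) := fun j => by
        simp only [hf, Nat.add_sub_cancel]
        push_cast
        rw [← mul_assoc, hrel j]; ring
      have hs : Summable fun j : ℕ => f (j + 1) := by
        simp_rw [hfs]
        exact (summable_bess (show -1 < ν + 1 by linarith) u).neg
      rw [Summable.tsum_eq_zero_add (f := f) ((summable_nat_add_iff 1).mp hs)]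
      simp_rw [hfs, tsum_neg]
      simp only [hf, Nat.cast_zero, zero_mul, mul_zero, zero_add]
      rfl
    rw [← e]; exact key
  · rw [← summable_nat_add_iff 1]
    refine Summable.of_nonneg_of_le (fun j => by positivity) (fun j => ?_)
      ((Real.summable_pow_div_factorial R).mul_left C')
    simp only [Nat.add_sub_cancel]
    push_cast
    rw [← mul_assoc, ← abs_of_nonneg (show (0 : ℝ) ≤ (j : ℝ) + 1 by positivity), ← abs_mul,
      hrel j, abs_neg]
    calc _ ≤ C' / (Nat.factorial j : ℝ) * R ^ j := by gcongr; exact h' j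
      _ = _ := by ring
  · intro j z _
    exact (hasDerivAt_pow j z).const_mul (c j)
  · intro j z hz
    rw [mem_ball_zero_iff, Real.norm_eq_abs] at hz
    rw [Real.norm_eq_abs, abs_mul, abs_mul, abs_pow, Nat.abs_cast]
    gcongr

theorem continuous_bess {ν : ℝ} (hν : -1 < ν) : Continuous (bess ν) :=
  continuous_iff_continuousAt.mpr fun u => (hasDerivAt_bess hν u).continuousAt

/-- The three-term Bessel recurrence: compare coefficients using `Γ(z+1) = zΓ(z)`. -/
theorem bess_recurrence {ν : ℝ} (hν : -1 < ν) (u : ℝ) :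
    bess ν u = (ν + 1) * bess (ν + 1) u - u * bess (ν + 2) u := by
  have h1 := (summable_bess (show -1 < ν + 1 by linarith) u).mul_left (ν + 1)
  have h2 := (summable_bess (show -1 < ν + 2 by linarith) u).mul_left u
  have hG : ∀ j : ℕ, Real.Gamma (ν + j + 1) ≠ 0 := fun j =>
    (Real.Gamma_pos_of_pos (by have : (0:ℝ) ≤ j := by positivity
                               linarith)).ne'
  have hGs : ∀ j : ℕ, Real.Gamma (ν + 1 + j + 1) = (ν + j + 1) * Real.Gamma (ν + j + 1) := by
    intro j
    have : (0:ℝ) ≤ j := by positivity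
    rw [← Real.Gamma_add_one (by linarith)]; congr 1; ring
  have hpos : ∀ j : ℕ, ν + j + 1 ≠ 0 := fun j => by
    have : (0:ℝ) ≤ j := by positivity
    linarith
  rw [bess, bess, bess, ← tsum_mul_left, ← tsum_mul_left,
    Summable.tsum_eq_zero_add (summable_bess hν u), Summable.tsum_eq_zero_add h1,
    add_sub_assoc, ← Summable.tsum_sub ((summable_nat_add_iff 1).mpr h1) h2]
  congr 1
  · have := hGs 0
    have h0 := hG 0
    have h3 := hpos 0
    simp only [Nat.cast_zero, add_zero] at this h0 h3
    simp only [pow_zero, Nat.factorial_zero, Nat.cast_one, one_mul, Nat.cast_zero, add_zero,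
      mul_one]
    rw [this]; field_simp
  · refine tsum_congr fun j => ?_
    have e1 : ν + 2 + (j : ℝ) + 1 = ν + 1 + (j + 1 : ℕ) + 1 := by push_cast; ring
    rw [e1, hGs (j + 1), Nat.factorial_succ]
    have h0 := hG (j + 1)
    have h3 := hpos (j + 1)
    have hf : (Nat.factorial j : ℝ) ≠ 0 := by positivity
    have hj : (j : ℝ) + 1 ≠ 0 := by positivity
    push_cast at h0 h3 ⊢
    field_simp
    ring

/-- The derivative of `t^{2μ} bess μ (c t²)` is `2 t^{2μ-1} bess (μ-1) (c t²)`. -/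
theorem hasDerivAt_pow_mul_bess (N : ℕ) (c t : ℝ) :
    HasDerivAt (fun t : ℝ => t ^ (N + 1) * bess ((N + 1 : ℝ) / 2) (c * t ^ 2))
      (2 * t ^ N * bess ((N + 1 : ℝ) / 2 - 1) (c * t ^ 2)) t := by
  have hN : (0 : ℝ) ≤ N := by positivity
  have hin : HasDerivAt (fun t : ℝ => c * t ^ 2) (c * (2 * t)) t := by
    simpa using (hasDerivAt_pow 2 t).const_mul c
  have h := (hasDerivAt_pow (N + 1) t).mul
    ((hasDerivAt_bess (show -1 < (N + 1 : ℝ) / 2 by linarith) (c * t ^ 2)).comp t hin)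
  refine h.congr_deriv ?_
  rw [bess_recurrence (show -1 < (N + 1 : ℝ) / 2 - 1 by linarith) (c * t ^ 2)]
  have e1 : (N + 1 : ℝ) / 2 - 1 + 1 = (N + 1) / 2 := by ring
  have e2 : (N + 1 : ℝ) / 2 - 1 + 2 = (N + 1) / 2 + 1 := by ring
  rw [e1, e2]
  simp only [Function.comp, Nat.add_sub_cancel]
  push_cast
  ring

/-- The energy `t^N B² + t^{N+2} C² - (N+1)/2 t^N B C` is antitone for large `t`, which bounds the
Bessel function `J_{N/2}`. -/
theorem exists_bess_bound (N : ℕ) (hN : 1 ≤ N) :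
    ∃ C : ℝ, 0 ≤ C ∧ ∀ t : ℝ, 0 ≤ t → t ^ N * bess (N / 2) (t ^ 2) ^ 2 ≤ C := by
  have hN' : (1 : ℝ) ≤ N := by exact_mod_cast hN
  have hν : -1 < (N : ℝ) / 2 := by linarith
  set B : ℝ → ℝ := fun t => bess (N / 2) (t ^ 2) with hB
  set C : ℝ → ℝ := fun t => bess (N / 2 + 1) (t ^ 2) with hC
  have hin : ∀ t : ℝ, HasDerivAt (fun t : ℝ => t ^ 2) (2 * t) t := fun t => by
    simpa using hasDerivAt_pow 2 t
  have dB : ∀ t, HasDerivAt B (-(2 * t * C t)) t := fun t => by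
    refine ((hasDerivAt_bess hν (t ^ 2)).comp t (hin t)).congr_deriv ?_
    simp only [hC]; ring
  have dC : ∀ t, 0 < t → HasDerivAt C ((2 * B t - (N + 2) * C t) / t) t := fun t ht => by
    refine ((hasDerivAt_bess (show -1 < (N : ℝ) / 2 + 1 by linarith) (t ^ 2)).comp t
      (hin t)).congr_deriv ?_
    have hr := bess_recurrence hν (t ^ 2)
    have e : (N : ℝ) / 2 + 1 + 1 = N / 2 + 2 := by ring
    simp only [hC, hB]
    rw [e, hr]
    field_simp
    ring
  have cB : Continuous B := continuous_iff_continuousAt.mpr fun t => (dB t).continuousAt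
  have cC : Continuous C :=
    (continuous_bess (show -1 < (N : ℝ) / 2 + 1 by linarith)).comp (continuous_pow 2)
  -- Without the cross term the derivative is `t^{N-1}(N B² - (N+2) t² C²)`, of no fixed sign. The
  -- factor `(N+1)/2` turns this into `-t^{N-1}(B² + t² C²)` plus a multiple of `BC`.
  set E : ℝ → ℝ := fun t => t ^ N * B t ^ 2 + t ^ (N + 2) * C t ^ 2
    - (N + 1) / 2 * (t ^ N * (B t * C t)) with hE
  -- From here on `B² + t² C² ≥ 2t|BC| ≥ (N+1)|BC|`, so the cross terms are dominated both in `E`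
  -- and in its derivative.
  set t₀ : ℝ := (N + 1) / 2 with ht₀
  have ht₀pos : 0 < t₀ := by positivity
  have cross : ∀ t, t₀ ≤ t → (N + 1) * |B t * C t| ≤ B t ^ 2 + t ^ 2 * C t ^ 2 := by
    intro t ht
    have h1 : (N + 1 : ℝ) ≤ 2 * t := by linarith
    have h2 : 0 ≤ (|B t| - t * |C t|) ^ 2 := sq_nonneg _
    have h3 : 0 ≤ |B t| * |C t| := by positivity
    rw [abs_mul]
    have e1 := sq_abs (B t)
    have e2 := sq_abs (C t)
    nlinarith
  have dE : ∀ t, 0 < t → HasDerivAt E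
      (t ^ (N - 1) * ((N + 1) * (B t * C t) - B t ^ 2 - t ^ 2 * C t ^ 2)) t := by
    intro t ht
    have h := (((hasDerivAt_pow N t).mul ((dB t).pow 2)).add
      ((hasDerivAt_pow (N + 2) t).mul ((dC t ht).pow 2))).sub
      (((hasDerivAt_pow N t).mul ((dB t).mul (dC t ht))).const_mul ((N + 1 : ℝ) / 2))
    refine h.congr_deriv ?_
    obtain ⟨n, rfl⟩ : ∃ n, N = n + 1 := ⟨N - 1, by omega⟩
    simp only [Nat.add_sub_cancel, Pi.pow_apply, Pi.mul_apply]
    push_cast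
    field_simp
    ring
  have anti : AntitoneOn E (Ici t₀) := by
    refine antitoneOn_of_deriv_nonpos (convex_Ici _) (by fun_prop) ?_ ?_
    · intro t ht
      rw [interior_Ici] at ht
      exact (dE t (ht₀pos.trans ht)).differentiableAt.differentiableWithinAt
    · intro t ht
      rw [interior_Ici] at ht
      have htp : 0 < t := ht₀pos.trans ht
      rw [(dE t htp).deriv]
      have h1 := cross t (le_of_lt ht)
      have h2 : (N + 1) * (B t * C t) ≤ (N + 1) * |B t * C t| := by gcongr; exact le_abs_self _
      exact mul_nonpos_of_nonneg_of_nonpos (by positivity) (by linarith)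
  obtain ⟨M, hM⟩ := (isCompact_Icc (a := (0 : ℝ)) (b := t₀)).bddAbove_image
    (f := fun t => t ^ N * B t ^ 2) (by fun_prop)
  refine ⟨max (max M 0) (2 * E t₀), le_max_of_le_left (le_max_right _ _), fun t ht => ?_⟩
  rcases le_total t t₀ with h | h
  · exact le_max_of_le_left (le_max_of_le_left (hM ⟨t, ⟨ht, h⟩, rfl⟩))
  -- Beyond `t₀` the cross term costs at most half of the energy, so `t^N B² ≤ 2 E t ≤ 2 E t₀`.
  · refine le_max_of_le_right ?_
    have h1 := anti (mem_Ici.mpr le_rfl) h h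
    have h2 := cross t h
    have h3 : (N + 1) * (B t * C t) ≤ (N + 1) * |B t * C t| := by gcongr; exact le_abs_self _
    have h4 : (0 : ℝ) ≤ t ^ N * (B t ^ 2 + t ^ 2 * C t ^ 2 - (N + 1) * (B t * C t)) :=
      mul_nonneg (by positivity) (by linarith)
    have h5 : 0 ≤ t ^ N * (t ^ 2 * C t ^ 2) := by positivity
    change t ^ N * B t ^ 2 ≤ 2 * E t₀
    have h6 : E t = t ^ N * B t ^ 2 + t ^ N * (t ^ 2 * C t ^ 2)
      - (N + 1) / 2 * (t ^ N * (B t * C t)) := by simp only [hE]; ring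
    nlinarith

theorem Lam_eq {ν t s : ℝ} (ht : 0 < t) (hs : 0 ≤ s) :
    Lam ν t s = (Real.pi * t) ^ ν * bess ν (Real.pi ^ 2 * t ^ 2 * s) := by
  have hπ := Real.pi_pos
  rcases hs.eq_or_lt with rfl | hs
  · simp [Lam, bess_zero, div_eq_mul_inv]
  · rw [Lam, if_neg hs.ne', besselJ, bess, ← tsum_mul_left, ← tsum_div_const]
    refine tsum_congr fun j => ?_
    have e : 2 * Real.pi * t * Real.sqrt s / 2 = Real.pi * t * Real.sqrt s := by ring
    have hsq : Real.sqrt s ^ (2 * (j : ℝ) + ν) = s ^ j * s ^ (ν / 2) := by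
      rw [Real.sqrt_eq_rpow, ← Real.rpow_mul hs.le, ← Real.rpow_natCast, ← Real.rpow_add hs]
      congr 1; ring
    rw [e, Real.mul_rpow (by positivity) (Real.sqrt_nonneg s), hsq,
      Real.rpow_add (by positivity), show 2 * (j : ℝ) = ((2 * j : ℕ) : ℝ) by push_cast; ring,
      Real.rpow_natCast]
    have h1 : s ^ (ν / 2) ≠ 0 := (Real.rpow_pos_of_pos hs _).ne'
    field_simp
    ring

/-! ### Polar coordinates and the Fourier transform of the sphere. -/

/-- The surface measure of the unit sphere of `ℝ^d`. -/
abbrev surf (d : ℕ) : Measure (Metric.sphere (0 : E d) 1) := (volume : Measure (E d)).toSphere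

theorem nontrivial_E {d : ℕ} (hd : 1 ≤ d) : Nontrivial (E d) := by
  have : Nonempty (Fin d) := ⟨⟨0, hd⟩⟩
  infer_instance

/-- Integration in polar coordinates. -/
theorem integral_polar {d : ℕ} (hd : 1 ≤ d) {f : E d → ℂ} (hf : Integrable f) :
    ∫ x, f x = ∫ t in Ioi (0 : ℝ), (t : ℂ) ^ (d - 1) * ∫ θ, f (t • θ.1) ∂(surf d) := by
  have := nontrivial_E hd
  have hmp := (volume : Measure (E d)).measurePreserving_homeomorphUnitSphereProd
  have hfr : Module.finrank ℝ (E d) = d := by simp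
  rw [hfr] at hmp
  have hemb := (homeomorphUnitSphereProd (E d)).measurableEmbedding
  set g : Metric.sphere (0 : E d) 1 × Ioi (0 : ℝ) → ℂ := fun p => f (p.2.1 • p.1.1) with hg
  have hgf : ∀ x : ({0}ᶜ : Set (E d)), g (homeomorphUnitSphereProd (E d) x) = f x := by
    intro x
    have : (‖x.1‖ : ℝ) ≠ 0 := norm_ne_zero_iff.mpr x.2
    simp [hg, smul_smul, this]
  have hint : Integrable g ((surf d).prod (.volumeIoiPow (d - 1))) := by
    rw [← hmp.integrable_comp_emb hemb]
    have : (g ∘ homeomorphUnitSphereProd (E d)) = fun x => f x.1 := funext hgf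
    rw [this]
    exact (integrableOn_iff_comap_subtypeVal (measurableSet_singleton _).compl).mp
      hf.integrableOn
  calc ∫ x, f x = ∫ x : ({(0)}ᶜ : Set (E d)), f x.1
          ∂((volume : Measure (E d)).comap Subtype.val) := by
        rw [integral_subtype_comap (measurableSet_singleton _).compl f, restrict_compl_singleton]
    _ = ∫ p, g p ∂((surf d).prod (.volumeIoiPow (d - 1))) := by
        rw [← hmp.integral_comp hemb]
        exact integral_congr_ae (.of_forall fun x => (hgf x).symm)
    _ = ∫ t : Ioi (0 : ℝ), ∫ θ, f (t.1 • θ.1) ∂(surf d) ∂(.volumeIoiPow (d - 1)) := by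
        rw [integral_prod_symm _ hint]
    _ = _ := by
      simp only [Measure.volumeIoiPow, ENNReal.ofReal]
      rw [integral_withDensity_eq_integral_smul,
        integral_subtype_comap measurableSet_Ioi
          fun a ↦ Real.toNNReal (a ^ (d - 1)) • ∫ θ, f (a • θ.1) ∂(surf d),
        setIntegral_congr_fun measurableSet_Ioi fun x hx ↦ ?_]
      · rw [NNReal.smul_def, Real.coe_toNNReal _ (pow_nonneg hx.out.le _), Complex.real_smul]
        push_cast; rfl
      · exact (measurable_subtype_coe.pow_const _).real_toNNReal

/-- The moments `∫_{S^{d-1}} ⟨θ,y⟩^k dθ`. -/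
def sphereMoment {d : ℕ} (k : ℕ) (y : E d) : ℂ := ∫ θ, ((inner ℝ θ.1 y : ℝ) : ℂ) ^ k ∂(surf d)

theorem hasSum_integral_sphere_exp {d : ℕ} (z : ℂ) (y : E d) :
    HasSum (fun k : ℕ => z ^ k / (Nat.factorial k : ℂ) * sphereMoment k y)
      (∫ θ, Complex.exp (z * ((inner ℝ θ.1 y : ℝ) : ℂ)) ∂(surf d)) := by
  have hcont : Continuous fun θ : Metric.sphere (0 : E d) 1 => ((inner ℝ θ.1 y : ℝ) : ℂ) := by
    fun_prop
  have := hasSum_integral_of_dominated_convergence (μ := surf d)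
    (F := fun (k : ℕ) θ => z ^ k / (Nat.factorial k : ℂ) * ((inner ℝ θ.1 y : ℝ) : ℂ) ^ k)
    (f := fun θ => Complex.exp (z * ((inner ℝ θ.1 y : ℝ) : ℂ)))
    (fun k _ => (‖z‖ * ‖y‖) ^ k / (Nat.factorial k : ℝ)) ?_ ?_ ?_ ?_ ?_
  · simp only [integral_const_mul] at this
    exact this
  · intro k
    exact (Continuous.aestronglyMeasurable (by fun_prop))
  · intro k
    refine .of_forall fun θ => ?_
    have h1 : |inner ℝ θ.1 y| ≤ ‖y‖ := by
      have := abs_real_inner_le_norm θ.1 y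
      rwa [norm_eq_of_mem_sphere θ, one_mul] at this
    rw [norm_mul, norm_div, norm_pow, norm_pow, Complex.norm_real, Real.norm_eq_abs,
      Complex.norm_natCast, mul_pow]
    calc _ ≤ ‖z‖ ^ k / (Nat.factorial k : ℝ) * ‖y‖ ^ k := by gcongr
      _ = _ := by ring
  · exact .of_forall fun _ => Real.summable_pow_div_factorial _
  · exact integrable_const _
  · refine .of_forall fun θ => ?_
    have h := NormedSpace.expSeries_div_hasSum_exp (𝔸 := ℂ) (z * ((inner ℝ θ.1 y : ℝ) : ℂ))
    rw [← Complex.exp_eq_exp_ℂ] at h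
    refine h.congr_fun fun k => ?_
    rw [mul_pow]; ring

/-- Since `e^{c|u|} ≤ e^{cu} + e^{-cu}`, two shifted Gaussians dominate. The result majorizes the
termwise integration of the moment series. -/
theorem integrable_gauss_mul_exp_abs {d : ℕ} (c : ℝ) (y : E d) :
    Integrable fun x : E d => Real.exp (c * |inner ℝ y x|) * Real.exp (-‖x‖ ^ 2) := by
  have h : ∀ a : ℝ, Integrable fun x : E d => Real.exp (-‖x‖ ^ 2 + a * inner ℝ y x) := by
    intro a
    have := (GaussianFourier.integrable_cexp_neg_mul_sq_norm_add (V := E d) (b := 1)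
      (by simp) (a : ℂ) y).norm
    refine this.congr (.of_forall fun x => ?_)
    simp only [Complex.norm_exp]
    congr 1
    simp [← Complex.ofReal_pow]
  refine ((h c).add (h (-c))).mono' (Continuous.aestronglyMeasurable (by fun_prop))
    (.of_forall fun x => ?_)
  rw [← Real.exp_add, Real.norm_eq_abs, Real.abs_exp, Pi.add_apply]
  rcases abs_cases (inner ℝ y x) with ⟨h1, _⟩ | ⟨h1, _⟩ <;> rw [h1]
  · rw [add_comm]; exact le_add_of_nonneg_right (Real.exp_nonneg _)
  · rw [add_comm, mul_neg, ← neg_mul]; exact le_add_of_nonneg_left (Real.exp_nonneg _)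

/-- The Gaussian moments `∫ ⟨y,x⟩^k e^{-|x|²} dx`. -/
def gaussMoment {d : ℕ} (k : ℕ) (y : E d) : ℂ :=
  ∫ x : E d, ((inner ℝ y x : ℝ) : ℂ) ^ k * Complex.exp (-(‖x‖ : ℂ) ^ 2)

theorem norm_cexp_neg_sq (r : ℝ) : ‖Complex.exp (-(r : ℂ) ^ 2)‖ = Real.exp (-r ^ 2) := by
  rw [Complex.norm_exp]
  simp [← Complex.ofReal_pow]

/-- The generating function of the moments is the Gaussian integral of `e^{c⟨y,x⟩}`, known in closed
form; the moments can then be read off as its Taylor coefficients in `c`. -/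
theorem hasSum_gaussMoment {d : ℕ} (c : ℂ) (y : E d) :
    HasSum (fun k : ℕ => c ^ k / (Nat.factorial k : ℂ) * gaussMoment k y)
      ((Real.pi : ℂ) ^ ((d : ℂ) / 2) * Complex.exp (c ^ 2 * ‖y‖ ^ 2 / 4)) := by
  have := hasSum_integral_of_dominated_convergence (μ := (volume : Measure (E d)))
    (F := fun (k : ℕ) x => c ^ k / (Nat.factorial k : ℂ) *
      (((inner ℝ y x : ℝ) : ℂ) ^ k * Complex.exp (-(‖x‖ : ℂ) ^ 2)))
    (f := fun x => Complex.exp (-1 * (‖x‖ : ℂ) ^ 2 + c * ((inner ℝ y x : ℝ) : ℂ)))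
    (fun k x => (‖c‖ * |inner ℝ y x|) ^ k / (Nat.factorial k : ℝ) * Real.exp (-‖x‖ ^ 2))
    ?_ ?_ ?_ ?_ ?_
  · simp only [integral_const_mul] at this
    rw [GaussianFourier.integral_cexp_neg_mul_sq_norm_add (V := E d) (by simp) c y] at this
    simpa [gaussMoment] using this
  · intro k
    exact (Continuous.aestronglyMeasurable (by fun_prop))
  · intro k
    refine .of_forall fun x => le_of_eq ?_
    rw [norm_mul, norm_mul, norm_div, norm_pow, norm_pow, Complex.norm_real, Real.norm_eq_abs,
      Complex.norm_natCast, mul_pow, norm_cexp_neg_sq]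
    ring
  · exact .of_forall fun x => (Real.summable_pow_div_factorial _).mul_right _
  · refine (integrable_gauss_mul_exp_abs ‖c‖ y).congr (.of_forall fun x => ?_)
    simp only [tsum_mul_right]
    rw [Real.exp_eq_exp_ℝ, NormedSpace.exp_eq_tsum_div]
  · refine .of_forall fun x => ?_
    have h := NormedSpace.expSeries_div_hasSum_exp (𝔸 := ℂ) (c * ((inner ℝ y x : ℝ) : ℂ))
    rw [← Complex.exp_eq_exp_ℂ] at h
    rw [Complex.exp_add, mul_comm]
    have h' := h.mul_right (Complex.exp (-1 * (‖x‖ : ℂ) ^ 2))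
    refine h'.congr_fun fun k => ?_
    rw [mul_pow]; simp only [neg_mul, one_mul]; ring

theorem coeff_eq_of_hasSum {a b : ℕ → ℂ} {f : ℂ → ℂ} (ha : ∀ z, HasSum (fun k => z ^ k * a k) (f z))
    (hb : ∀ z, HasSum (fun k => z ^ k * b k) (f z)) : a = b := by
  have key : ∀ a : ℕ → ℂ, (∀ z, HasSum (fun k => z ^ k * a k) (f z)) →
      HasFPowerSeriesAt f (FormalMultilinearSeries.ofScalars ℂ a) 0 := by
    intro a ha
    rw [hasFPowerSeriesAt_iff]
    refine .of_forall fun z => ?_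
    simpa [FormalMultilinearSeries.coeff_ofScalars] using ha z
  have h := (key a ha).eq_formalMultilinearSeries (key b hb)
  funext k
  have := congrArg (fun p => FormalMultilinearSeries.coeff p k) h
  simpa [FormalMultilinearSeries.coeff_ofScalars] using this

theorem gaussMoment_div_factorial {d : ℕ} (y : E d) (k : ℕ) :
    gaussMoment k y / (Nat.factorial k : ℂ) =
      if Even k then (Real.pi : ℂ) ^ ((d : ℂ) / 2) *
        ((‖y‖ : ℂ) ^ 2 / 4) ^ (k / 2) / (Nat.factorial (k / 2) : ℂ) else 0 := by
  refine congrFun (coeff_eq_of_hasSum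
    (a := fun k => gaussMoment k y / (Nat.factorial k : ℂ))
    (b := fun k => if Even k then (Real.pi : ℂ) ^ ((d : ℂ) / 2) *
        ((‖y‖ : ℂ) ^ 2 / 4) ^ (k / 2) / (Nat.factorial (k / 2) : ℂ) else 0)
    (f := fun c => (Real.pi : ℂ) ^ ((d : ℂ) / 2) * Complex.exp (c ^ 2 * ‖y‖ ^ 2 / 4))
    (fun z => (hasSum_gaussMoment z y).congr_fun fun k => by ring) fun z => ?_) k
  rw [← add_zero ((Real.pi : ℂ) ^ ((d : ℂ) / 2) * Complex.exp (z ^ 2 * ‖y‖ ^ 2 / 4))]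
  refine HasSum.even_add_odd ?_ ?_
  · have h := NormedSpace.expSeries_div_hasSum_exp (𝔸 := ℂ) (z ^ 2 * ‖y‖ ^ 2 / 4)
    rw [← Complex.exp_eq_exp_ℂ] at h
    refine (h.mul_left _).congr_fun fun k => ?_
    simp only [even_two, Even.mul_right, if_true, Nat.mul_div_cancel_left k two_pos]
    rw [mul_div_assoc (z ^ 2), mul_pow, ← pow_mul]
    ring
  · simp [hasSum_zero]

theorem integrable_gaussMoment {d : ℕ} (k : ℕ) (y : E d) :
    Integrable fun x : E d => ((inner ℝ y x : ℝ) : ℂ) ^ k * Complex.exp (-(‖x‖ : ℂ) ^ 2) := by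
  refine ((integrable_gauss_mul_exp_abs 1 y).const_mul (Nat.factorial k : ℝ)).mono'
    (Continuous.aestronglyMeasurable (by fun_prop)) (.of_forall fun x => ?_)
  rw [norm_mul, norm_pow, Complex.norm_real, Real.norm_eq_abs, norm_cexp_neg_sq, ← mul_assoc,
    one_mul]
  have := Real.pow_div_factorial_le_exp |inner ℝ y x| (abs_nonneg _) k
  rw [div_le_iff₀ (by positivity)] at this
  gcongr
  linarith

/-- In polar coordinates the Gaussian moment splits into the spherical moment and `∫ t^{k+d-1}
e^{-t²} dt`. This yields the spherical moments without integrating over the sphere directly. -/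
theorem gaussMoment_eq_sphereMoment {d : ℕ} (hd : 1 ≤ d) (k : ℕ) (y : E d) :
    gaussMoment k y = sphereMoment k y * (Real.Gamma (((k : ℝ) + d) / 2) / 2 : ℝ) := by
  rw [gaussMoment, integral_polar hd (integrable_gaussMoment k y)]
  have h := integral_rpow_mul_exp_neg_rpow (p := 2) (q := (k + d - 1 : ℕ)) two_pos
    (lt_of_lt_of_le (by norm_num) (Nat.cast_nonneg _))
  have e1 : ((((k + d - 1 : ℕ) : ℝ) + 1) / 2) = ((k : ℝ) + d) / 2 := by
    have : ((k + d - 1 : ℕ) : ℝ) + 1 = k + d := by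
      have : k + d - 1 + 1 = k + d := by omega
      exact_mod_cast this
    rw [this]
  rw [e1, one_div, mul_comm, ← div_eq_mul_inv] at h
  rw [← h, ← integral_complex_ofReal, ← integral_const_mul]
  refine setIntegral_congr_fun measurableSet_Ioi fun t ht => ?_
  have ht0 : (0 : ℝ) < t := ht
  have e2 : ∀ θ : Metric.sphere (0 : E d) 1,
      ((inner ℝ y (t • θ.1) : ℝ) : ℂ) ^ k * Complex.exp (-(‖t • θ.1‖ : ℂ) ^ 2)
      = ((t : ℂ) ^ k * Complex.exp (-(t : ℂ) ^ 2)) * ((inner ℝ θ.1 y : ℝ) : ℂ) ^ k := by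
    intro θ
    rw [inner_smul_right, norm_smul, norm_eq_of_mem_sphere θ, Real.norm_eq_abs, abs_of_pos ht0,
      real_inner_comm]
    push_cast; rw [mul_one]; ring
  simp only [e2, integral_const_mul]
  rw [sphereMoment, Real.rpow_natCast]
  have e3 : k + d - 1 = (d - 1) + k := by omega
  rw [e3]
  push_cast
  simp only [Real.rpow_ofNat]
  push_cast
  ring

theorem ofReal_pi_cpow (d : ℕ) :
    (Real.pi : ℂ) ^ ((d : ℂ) / 2) = ((Real.pi ^ ((d : ℝ) / 2) : ℝ) : ℂ) := by
  rw [Complex.ofReal_cpow Real.pi_pos.le]; push_cast; rfl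

/-- The Fourier transform of the surface measure of the sphere. -/
theorem integral_sphere_exp {d : ℕ} (hd : 1 ≤ d) (t : ℝ) (y : E d) :
    ∫ θ, Complex.exp (2 * Real.pi * Complex.I * t * ((inner ℝ θ.1 y : ℝ) : ℂ)) ∂(surf d) =
      ((2 * Real.pi ^ ((d : ℝ) / 2) *
        bess ((d : ℝ) / 2 - 1) (Real.pi ^ 2 * ‖y‖ ^ 2 * t ^ 2) : ℝ) : ℂ) := by
  have hd' : (1 : ℝ) ≤ d := by exact_mod_cast hd
  set z : ℂ := 2 * Real.pi * Complex.I * t with hz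
  have h := hasSum_integral_sphere_exp z y
  have hG : ∀ k : ℕ, 0 < Real.Gamma (((k : ℝ) + d) / 2) := fun k =>
    Real.Gamma_pos_of_pos (by positivity)
  have hmom : ∀ k : ℕ, sphereMoment k y / (Nat.factorial k : ℂ) =
      (if Even k then (Real.pi : ℂ) ^ ((d : ℂ) / 2) *
        ((‖y‖ : ℂ) ^ 2 / 4) ^ (k / 2) / (Nat.factorial (k / 2) : ℂ) else 0)
        * (2 / (Real.Gamma (((k : ℝ) + d) / 2) : ℂ)) := by
    intro k
    rw [← gaussMoment_div_factorial y k, gaussMoment_eq_sphereMoment hd]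
    have := (Complex.ofReal_ne_zero.mpr (hG k).ne')
    push_cast
    field_simp
  -- The odd moments vanish, so only `k = 2j` contributes; there `Γ((k+d)/2) = Γ(d/2 - 1 + j + 1)`
  -- is the Gamma factor of the Bessel series.
  have hinj : Function.Injective fun j : ℕ => 2 * j := fun a b h => by simpa using h
  have h2 := (hinj.hasSum_iff (f := fun k : ℕ => z ^ k / (Nat.factorial k : ℂ) * sphereMoment k y)
    ?_).mpr h
  · have h3 := Complex.hasSum_ofReal.mpr
      ((summable_bess (show -1 < (d : ℝ) / 2 - 1 by linarith)
        (Real.pi ^ 2 * ‖y‖ ^ 2 * t ^ 2)).hasSum.mul_left (2 * Real.pi ^ ((d : ℝ) / 2)))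
    refine h2.unique (h3.congr_fun fun j => ?_)
    simp only [Function.comp]
    have e := hmom (2 * j)
    rw [if_pos (by simp), Nat.mul_div_cancel_left j two_pos, ofReal_pi_cpow] at e
    rw [div_mul_eq_mul_div, mul_div_assoc, e]
    have e5 : (((2 * j : ℕ) : ℝ) + d) / 2 = (d : ℝ) / 2 - 1 + j + 1 := by push_cast; ring
    rw [e5]
    have hG' := hG (2 * j)
    rw [e5] at hG'
    have hG'' := (Complex.ofReal_ne_zero.mpr hG'.ne')
    have hz2 : z ^ (2 * j) = (-1) ^ j * 4 ^ j * (Real.pi : ℂ) ^ (2 * j) * (t : ℂ) ^ (2 * j) := by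
      rw [hz, pow_mul, mul_pow, mul_pow, mul_pow, Complex.I_sq, pow_mul, pow_mul, ← mul_pow,
        ← mul_pow, ← mul_pow]
      ring
    rw [hz2]
    push_cast
    have hf : (Nat.factorial j : ℂ) ≠ 0 := by exact_mod_cast Nat.factorial_ne_zero j
    rw [div_pow, mul_pow, mul_pow, ← pow_mul, ← pow_mul, ← pow_mul]
    have h4 : (4 : ℂ) ^ j ≠ 0 := pow_ne_zero _ (by norm_num)
    field_simp
  · intro k hk
    have hodd : ¬ Even k := by
      rintro ⟨j, rfl⟩
      exact hk ⟨j, by simp; ring⟩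
    have e := hmom k
    rw [if_neg hodd, zero_mul] at e
    rw [div_mul_eq_mul_div, mul_div_assoc, e, mul_zero]

/-- The Fourier transform of a radial function as a Hankel transform. -/
theorem integral_radial_mul_e {d : ℕ} (hd : 1 ≤ d) {ψ : ℝ → ℂ}
    (hψ : Integrable fun x : E d => ψ ‖x‖) (y : E d) :
    ∫ x : E d, ψ ‖x‖ * e x y = ∫ t in Ioi (0 : ℝ), ψ t *
      ((2 * Real.pi ^ ((d : ℝ) / 2) * t ^ (d - 1) *
        bess ((d : ℝ) / 2 - 1) (Real.pi ^ 2 * ‖y‖ ^ 2 * t ^ 2) : ℝ) : ℂ) := by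
  have hce : Continuous fun x : E d => e x y := by unfold e; fun_prop
  have hint : Integrable fun x : E d => ψ ‖x‖ * e x y := by
    refine hψ.mul_bdd (c := 1) hce.aestronglyMeasurable (.of_forall fun x => le_of_eq ?_)
    rw [e, Complex.norm_exp]
    simp
  rw [integral_polar hd hint]
  refine setIntegral_congr_fun measurableSet_Ioi fun t ht => ?_
  have ht0 : (0 : ℝ) < t := ht
  have e2 : ∀ θ : Metric.sphere (0 : E d) 1, ψ ‖t • θ.1‖ * e (t • θ.1) y = ψ t *
      Complex.exp (2 * Real.pi * Complex.I * t * ((inner ℝ θ.1 y : ℝ) : ℂ)) := by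
    intro θ
    rw [norm_smul, norm_eq_of_mem_sphere θ, Real.norm_eq_abs, abs_of_pos ht0, mul_one, e,
      real_inner_smul_left]
    push_cast; congr 2; ring
  simp only [e2, integral_const_mul]
  rw [integral_sphere_exp hd t y]
  push_cast
  ring

/-! ### The continuous Riesz kernels `𝒟_k` in closed form. -/

/-- `π^{d/2} t^{d+2i} bess (d/2+i) (c t²)`; for `c = π²|y|²` and `t = √s` this is `𝒟_i(s:y)`. -/
def hank (d i : ℕ) (c t : ℝ) : ℝ :=
  Real.pi ^ ((d : ℝ) / 2) * (t ^ (d + 2 * i) * bess ((d : ℝ) / 2 + i) (c * t ^ 2))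

theorem continuous_hank (d i : ℕ) (c : ℝ) : Continuous (hank d i c) := by
  have := continuous_bess (show -1 < (d : ℝ) / 2 + i by
    have : (0 : ℝ) ≤ (d : ℝ) / 2 + i := by positivity
    linarith)
  unfold hank
  fun_prop

theorem hank_zero {d : ℕ} (hd : 1 ≤ d) (i : ℕ) (c : ℝ) : hank d i c 0 = 0 := by
  rw [hank, zero_pow (by omega), zero_mul, mul_zero]

theorem hasDerivAt_hank_zero {d : ℕ} (hd : 1 ≤ d) (c t : ℝ) :
    HasDerivAt (hank d 0 c)
      (2 * Real.pi ^ ((d : ℝ) / 2) * t ^ (d - 1) * bess ((d : ℝ) / 2 - 1) (c * t ^ 2)) t := by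
  obtain ⟨n, rfl⟩ : ∃ n, d = n + 1 := ⟨d - 1, by omega⟩
  have h := (hasDerivAt_pow_mul_bess n c t).const_mul (Real.pi ^ (((n + 1 : ℕ) : ℝ) / 2))
  unfold hank
  push_cast at h ⊢
  simp only [add_zero]
  exact h.congr_deriv (by ring)

theorem hasDerivAt_hank_succ (d i : ℕ) (c t : ℝ) :
    HasDerivAt (hank d (i + 1) c) (2 * t * hank d i c t) t := by
  have h := (hasDerivAt_pow_mul_bess (d + 2 * i + 1) c t).const_mul (Real.pi ^ ((d : ℝ) / 2))
  have e1 : (((d + 2 * i + 1 : ℕ) : ℝ) + 1) / 2 = (d : ℝ) / 2 + (i + 1 : ℕ) := by push_cast; ring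
  have e2 : (d : ℝ) / 2 + (i + 1 : ℕ) - 1 = (d : ℝ) / 2 + i := by push_cast; ring
  rw [e1, e2] at h
  unfold hank
  exact h.congr_deriv (by ring)

/-- Integration by parts; the boundary terms vanish at `τ` through the power and at `0` through `G 0
= 0`. -/
theorem integral_pow_mul_deriv (k : ℕ) (τ : ℝ) {G G' : ℝ → ℝ} (hG : ∀ t, HasDerivAt G (G' t) t)
    (hG' : Continuous G') (h0 : G 0 = 0) :
    ∫ t in (0 : ℝ)..τ, (τ ^ 2 - t ^ 2) ^ (k + 1) / (Nat.factorial (k + 1) : ℝ) * G' t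
      = ∫ t in (0 : ℝ)..τ, (τ ^ 2 - t ^ 2) ^ k / (Nat.factorial k : ℝ) * (2 * t * G t) := by
  have hGc : Continuous G := continuous_iff_continuousAt.mpr fun t => (hG t).continuousAt
  have hu : ∀ t : ℝ, HasDerivAt
      (fun t : ℝ => (τ ^ 2 - t ^ 2) ^ (k + 1) / (Nat.factorial (k + 1) : ℝ))
      (-((τ ^ 2 - t ^ 2) ^ k / (Nat.factorial k : ℝ) * (2 * t))) t := by
    intro t
    have h := ((((hasDerivAt_pow 2 t).const_sub (τ ^ 2)).pow (k + 1)).div_const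
      (Nat.factorial (k + 1) : ℝ))
    refine h.congr_deriv ?_
    have hf : (Nat.factorial k : ℝ) ≠ 0 := by positivity
    have hk : (k : ℝ) + 1 ≠ 0 := by positivity
    rw [Nat.factorial_succ]
    push_cast
    simp only [pow_one]
    field_simp
  rw [intervalIntegral.integral_mul_deriv_eq_deriv_mul (fun t _ => hu t) (fun t _ => hG t)
    (Continuous.intervalIntegrable (by fun_prop) _ _) (hG'.intervalIntegrable _ _), h0]
  simp only [sub_self, ne_eq, Nat.add_eq_zero_iff, one_ne_zero, and_false, not_false_eq_true,
    zero_pow, zero_div, zero_mul, mul_zero, zero_sub]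
  rw [← intervalIntegral.integral_neg]
  congr 1; funext t; ring

/-- Each integration by parts trades one power of `τ² - t²` for one order of `hank`, so `i` must
vary in the induction. -/
theorem integral_pow_mul_hank {d : ℕ} (hd : 1 ≤ d) (c τ : ℝ) (k i : ℕ) :
    ∫ t in (0 : ℝ)..τ, (τ ^ 2 - t ^ 2) ^ k / (Nat.factorial k : ℝ) * (2 * t * hank d i c t)
      = hank d (k + 1 + i) c τ := by
  induction k generalizing i with
  | zero =>
    have hc := continuous_hank d i c
    simp only [pow_zero, Nat.factorial_zero, Nat.cast_one, div_one, one_mul, zero_add]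
    rw [intervalIntegral.integral_eq_sub_of_hasDerivAt (fun t _ => hasDerivAt_hank_succ d i c t)
      (Continuous.intervalIntegrable (by fun_prop) _ _), hank_zero hd, sub_zero, add_comm]
  | succ k ih =>
    have hc := continuous_hank d i c
    rw [integral_pow_mul_deriv k τ (hasDerivAt_hank_succ d i c) (by fun_prop) (hank_zero hd _ _),
      ih (i + 1)]
    congr 1; omega

theorem integral_pow_mul_bess {d : ℕ} (hd : 1 ≤ d) (c τ : ℝ) (k : ℕ) :
    ∫ t in (0 : ℝ)..τ, (τ ^ 2 - t ^ 2) ^ k / (Nat.factorial k : ℝ) *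
      (2 * Real.pi ^ ((d : ℝ) / 2) * t ^ (d - 1) * bess ((d : ℝ) / 2 - 1) (c * t ^ 2))
      = hank d k c τ := by
  have hd' : (1 : ℝ) ≤ d := by exact_mod_cast hd
  have hb := continuous_bess (show -1 < (d : ℝ) / 2 - 1 by linarith)
  cases k with
  | zero =>
    simp only [pow_zero, Nat.factorial_zero, Nat.cast_one, div_one, one_mul]
    rw [intervalIntegral.integral_eq_sub_of_hasDerivAt (fun t _ => hasDerivAt_hank_zero hd c t)
      (Continuous.intervalIntegrable (by fun_prop) _ _), hank_zero hd, sub_zero]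
  | succ k =>
    rw [integral_pow_mul_deriv k τ (hasDerivAt_hank_zero hd c) (by fun_prop) (hank_zero hd _ _),
      integral_pow_mul_hank hd]

theorem norm_e {d : ℕ} (ξ x : E d) : ‖e ξ x‖ = 1 := by
  rw [e, Complex.norm_exp]
  simp

theorem continuous_e_left {d : ℕ} (x : E d) : Continuous fun ξ : E d => e ξ x := by
  unfold e; fun_prop

theorem measurableSet_norm_sq_lt {d : ℕ} (s : ℝ) : MeasurableSet {ξ : E d | ‖ξ‖ ^ 2 < s} :=
  (isOpen_lt (by fun_prop) continuous_const).measurableSet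

theorem norm_sq_lt_subset_closedBall {d : ℕ} (s : ℝ) :
    {ξ : E d | ‖ξ‖ ^ 2 < s} ⊆ Metric.closedBall 0 (Real.sqrt s) := by
  intro ξ hξ
  rw [mem_closedBall_zero_iff]
  exact (Real.lt_sqrt_of_sq_lt hξ).le

theorem integrableOn_norm_sq_lt {d : ℕ} (s : ℝ) {f : E d → ℂ} (hf : Continuous f) :
    IntegrableOn f {ξ : E d | ‖ξ‖ ^ 2 < s} :=
  (hf.continuousOn.integrableOn_compact (isCompact_closedBall _ _)).mono_set
    (norm_sq_lt_subset_closedBall s)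

theorem Dint_natCast {d : ℕ} (k : ℕ) (s : ℝ) (y : E d) :
    Dint k s y = ∫ ξ in {ξ : E d | ‖ξ‖ ^ 2 < s},
      (((s - ‖ξ‖ ^ 2) ^ k / (Nat.factorial k : ℝ) : ℝ) : ℂ) * e ξ y := by
  rw [Dint, Real.Gamma_nat_eq_factorial, ← integral_const_mul]
  refine integral_congr_ae (.of_forall fun ξ => ?_)
  simp only [Real.rpow_natCast]
  push_cast
  ring

theorem Dint_eq_hank {d : ℕ} (hd : 1 ≤ d) (k : ℕ) {s : ℝ} (hs : 0 ≤ s) (y : E d) :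
    Dint k s y = (hank d k (Real.pi ^ 2 * ‖y‖ ^ 2) (Real.sqrt s) : ℂ) := by
  set ψ : ℝ → ℂ := {t : ℝ | t ^ 2 < s}.indicator
    fun t => (((s - t ^ 2) ^ k / (Nat.factorial k : ℝ) : ℝ) : ℂ) with hψ
  have hind : ∀ x : E d, ψ ‖x‖ = {ξ : E d | ‖ξ‖ ^ 2 < s}.indicator
      (fun ξ => (((s - ‖ξ‖ ^ 2) ^ k / (Nat.factorial k : ℝ) : ℝ) : ℂ)) x := by
    intro x
    simp [hψ, indicator]
  have hint : Integrable fun x : E d => ψ ‖x‖ := by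
    simp_rw [hind]
    rw [integrable_indicator_iff (measurableSet_norm_sq_lt s)]
    exact integrableOn_norm_sq_lt s (by fun_prop)
  have h1 : Dint k s y = ∫ x : E d, ψ ‖x‖ * e x y := by
    rw [Dint_natCast, ← integral_indicator (measurableSet_norm_sq_lt s)]
    refine integral_congr_ae (.of_forall fun x => ?_)
    simp only [hind, indicator]
    split_ifs <;> simp
  rw [h1, integral_radial_mul_e hd hint, ← integral_pow_mul_bess hd, Real.sq_sqrt hs,
    ← intervalIntegral.integral_ofReal, intervalIntegral.integral_of_le (Real.sqrt_nonneg s),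
    integral_Ioc_eq_integral_Ioo, ← integral_indicator measurableSet_Ioi,
    ← integral_indicator measurableSet_Ioo]
  refine integral_congr_ae (.of_forall fun t => ?_)
  simp only [indicator, hψ, mem_Ioi, mem_Ioo, mem_ofPred_eq]
  by_cases h0 : 0 < t
  · by_cases h2 : t ^ 2 < s
    · rw [if_pos h0, if_pos h2, if_pos ⟨h0, Real.lt_sqrt_of_sq_lt h2⟩]
      push_cast; ring
    · rw [if_pos h0, if_neg h2, if_neg, zero_mul]
      rintro ⟨_, h3⟩
      exact h2 ((Real.lt_sqrt h0.le).mp h3)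
  · rw [if_neg h0, if_neg fun h => h0 h.1]

theorem continuousOn_Dint {d : ℕ} (hd : 1 ≤ d) (k : ℕ) (y : E d) :
    ContinuousOn (fun s => Dint k s y) (Ici 0) := by
  have hc := continuous_hank d k (Real.pi ^ 2 * ‖y‖ ^ 2)
  have : Continuous fun s : ℝ => (hank d k (Real.pi ^ 2 * ‖y‖ ^ 2) (Real.sqrt s) : ℂ) := by
    fun_prop
  exact this.continuousOn.congr fun s hs => Dint_eq_hank hd k hs y

theorem Dint_zero {d : ℕ} (hd : 1 ≤ d) (k : ℕ) (y : E d) : Dint k 0 y = 0 := by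
  rw [Dint_eq_hank hd k le_rfl, Real.sqrt_zero, hank_zero hd, Complex.ofReal_zero]

/-- Chain rule through `τ = √s`: the factor `2τ` from `hasDerivAt_hank_succ` cancels `1/(2√s)`. The
root is not differentiable at `0`, hence `s > 0`. -/
theorem hasDerivAt_Dint {d : ℕ} (hd : 1 ≤ d) (k : ℕ) (y : E d) {s : ℝ} (hs : 0 < s) :
    HasDerivAt (fun s => Dint (k + 1 : ℕ) s y) (Dint k s y) s := by
  set c := Real.pi ^ 2 * ‖y‖ ^ 2
  have h := (((hasDerivAt_hank_succ d k c (Real.sqrt s)).comp s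
    (Real.hasDerivAt_sqrt hs.ne')).ofReal_comp).congr_of_eventuallyEq
    (f₁ := fun s => Dint (k + 1 : ℕ) s y) ?_
  · refine h.congr_deriv ?_
    rw [Dint_eq_hank hd k hs.le]
    have : Real.sqrt s ≠ 0 := (Real.sqrt_pos.mpr hs).ne'
    congr 1
    field_simp
    rfl
  · filter_upwards [lt_mem_nhds hs] with u hu
    exact Dint_eq_hank hd (k + 1) hu.le y

/-- Integration by parts against `𝒟_k`. -/
theorem integral_Dint_mul {d : ℕ} (hd : 1 ≤ d) (k : ℕ) (y : E d) {L : ℝ} (hL : 0 ≤ L)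
    {g g' : ℝ → ℂ} (hg : ∀ s, HasDerivAt g (g' s) s) (hg' : Continuous g') :
    ∫ s in (0 : ℝ)..L, Dint k s y * g s =
      Dint (k + 1 : ℕ) L y * g L - ∫ s in (0 : ℝ)..L, Dint (k + 1 : ℕ) s y * g' s := by
  have hgc : Continuous g := continuous_iff_continuousAt.mpr fun t => (hg t).continuousAt
  have hsub : uIcc 0 L ⊆ Ici 0 := by rw [uIcc_of_le hL]; exact Icc_subset_Ici_self
  -- This form asks for derivatives only in the open interval, which avoids the endpoint `s = 0`;
  -- there `Dint_zero` kills the boundary term.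
  have h := intervalIntegral.integral_mul_deriv_eq_deriv_mul_of_hasDerivAt (a := 0) (b := L)
    (u := fun s => Dint (k + 1 : ℕ) s y) (v := g) (u' := fun s => Dint k s y) (v' := g')
    ((continuousOn_Dint hd (k + 1) y).mono hsub) hgc.continuousOn
    (fun s hs => hasDerivAt_Dint hd k y (by rw [min_eq_left hL] at hs; exact hs.1))
    (fun s _ => hg s) (((continuousOn_Dint hd k y).mono hsub).intervalIntegrable)
    (hg'.intervalIntegrable _ _)
  rw [h, Dint_zero hd]
  ring

/-- Decay of `𝒟_k(s:y)` in `y`, locally uniformly in `s`. -/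
theorem exists_Dint_decay {d : ℕ} (hd : 1 ≤ d) (k : ℕ) (L : ℝ) :
    ∃ C : ℝ, 0 ≤ C ∧ ∀ s ∈ Icc 0 L, ∀ y : E d, y ≠ 0 →
      ‖Dint k s y‖ ≤ C * ‖y‖ ^ (-((d : ℝ) / 2 + k)) := by
  -- The order `N/2` is then `d/2 + k`. The bound is applied at `π|y|√s`, and `𝒟_k²` is that bounded
  -- quantity times `|y|^{-N}` and a power of `s`.
  obtain ⟨C, hC, hb⟩ := exists_bess_bound (d + 2 * k) (by omega)
  have hπ := Real.pi_pos
  set N := d + 2 * k with hN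
  refine ⟨Real.sqrt (Real.pi ^ d / Real.pi ^ N * Real.sqrt L ^ N * C), Real.sqrt_nonneg _, ?_⟩
  intro s hs y hy
  have hy' : 0 < ‖y‖ := norm_pos_iff.mpr hy
  rw [Dint_eq_hank hd k hs.1, Complex.norm_real, Real.norm_eq_abs]
  set τ := Real.sqrt s
  have hτ : 0 ≤ τ := Real.sqrt_nonneg s
  have hτL : τ ≤ Real.sqrt L := Real.sqrt_le_sqrt hs.2
  have h1 := hb (Real.pi * ‖y‖ * τ) (by positivity)
  have e1 : ((N : ℕ) : ℝ) / 2 = (d : ℝ) / 2 + k := by rw [hN]; push_cast; ring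
  have e2 : (‖y‖ ^ (-((d : ℝ) / 2 + k))) = Real.sqrt ((‖y‖ ^ N)⁻¹) := by
    rw [Real.rpow_neg hy'.le, Real.sqrt_inv, Real.sqrt_eq_rpow, ← Real.rpow_natCast,
      ← Real.rpow_mul hy'.le, ← e1]
    congr 2; ring
  rw [e2, ← Real.sqrt_mul (by positivity)]
  refine Real.abs_le_sqrt ?_
  rw [e1, show (Real.pi * ‖y‖ * τ) ^ 2 = Real.pi ^ 2 * ‖y‖ ^ 2 * τ ^ 2 by ring] at h1
  have e3 : (Real.pi ^ ((d : ℝ) / 2)) ^ 2 = Real.pi ^ d := by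
    rw [← Real.rpow_natCast, ← Real.rpow_mul hπ.le, ← Real.rpow_natCast]
    congr 1; push_cast; ring
  set b := bess ((d : ℝ) / 2 + k) (Real.pi ^ 2 * ‖y‖ ^ 2 * τ ^ 2) with hbdef
  have e4 : hank d k (Real.pi ^ 2 * ‖y‖ ^ 2) τ ^ 2 =
      Real.pi ^ d / Real.pi ^ N * τ ^ N * ((Real.pi * ‖y‖ * τ) ^ N * b ^ 2) * (‖y‖ ^ N)⁻¹ := by
    rw [hank, ← hbdef, ← hN, mul_pow, e3, mul_pow, mul_pow, mul_pow]
    field_simp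
  rw [e4]
  gcongr

/-! ### Smoothness of `A_φ` and its identification with the Fourier transform. -/

/-- The `i`-th derivative of the smooth extension of `A_φ` to the whole line. -/
def Aext (d : ℕ) (φ : ℝ≥0 → ℂ) (i : ℕ) (s : ℝ) : ℂ :=
  ∫ t in Ioi (0 : ℝ), ((t : ℂ) ^ (d - 1) * φ t.toNNReal) *
    ((2 * Real.pi ^ ((d : ℝ) / 2) * (-(Real.pi ^ 2 * t ^ 2)) ^ i *
      bess ((d : ℝ) / 2 - 1 + i) (Real.pi ^ 2 * t ^ 2 * s) : ℝ) : ℂ)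

theorem exists_support_bound {φ : ℝ≥0 → ℂ} (hφ : HasCompactSupport φ) :
    ∃ R : ℝ, 0 < R ∧ ∀ t : ℝ≥0, R < t → φ t = 0 := by
  obtain ⟨R, hR⟩ := hφ.isCompact.isBounded.bddAbove
  refine ⟨R + 1, by positivity, fun t ht => ?_⟩
  by_contra h
  have h1 : t ≤ R := hR (subset_tsupport _ h)
  have h2 : (t : ℝ) ≤ R := by exact_mod_cast h1
  linarith

theorem integrableOn_pow_mul {d : ℕ} (hd : 1 ≤ d) {φ : ℝ≥0 → ℂ} (hi : Integrable (radial d φ)) :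
    IntegrableOn (fun t : ℝ => (t : ℂ) ^ (d - 1) * φ t.toNNReal) (Ioi 0) := by
  have := nontrivial_E hd
  have h := (integrable_fun_norm_addHaar (volume : Measure (E d))
    (f := fun t : ℝ => φ t.toNNReal)).mp (hi.congr (.of_forall fun x => by
      simp only [radial]
      congr 1
      ext; simp))
  refine h.congr (.of_forall fun t => ?_)
  simp [Complex.real_smul]

/-- Differentiation under the integral. Compact support confines `t` to `[0,R]`, where the kernel is
bounded uniformly for `s` near the given point, so a multiple of the integrable weight
`t^{d-1}|φ(t)|` dominates. -/
theorem hasDerivAt_Aext {d : ℕ} (hd : 1 ≤ d) {φ : ℝ≥0 → ℂ} (hφ : HasCompactSupport φ)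
    (hi : Integrable (radial d φ)) (i : ℕ) (s : ℝ) :
    HasDerivAt (Aext d φ i) (Aext d φ (i + 1) s) s := by
  have hd' : (1 : ℝ) ≤ d := by exact_mod_cast hd
  obtain ⟨R, hR, hsupp⟩ := exists_support_bound hφ
  have hw := integrableOn_pow_mul hd hi
  have hν : ∀ i : ℕ, -1 < (d : ℝ) / 2 - 1 + i := fun i => by
    have : (0 : ℝ) ≤ i := by positivity
    linarith
  set w : ℝ → ℂ := fun t => (t : ℂ) ^ (d - 1) * φ t.toNNReal with hwdef
  set K : ℕ → ℝ → ℝ → ℝ := fun i s t => 2 * Real.pi ^ ((d : ℝ) / 2) *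
    (-(Real.pi ^ 2 * t ^ 2)) ^ i * bess ((d : ℝ) / 2 - 1 + i) (Real.pi ^ 2 * t ^ 2 * s) with hK
  have hKc : ∀ i, Continuous fun p : ℝ × ℝ => K i p.1 p.2 := fun i => by
    have := continuous_bess (hν i)
    simp only [hK]
    fun_prop
  have hKc1 : ∀ i s, Continuous fun t => ((K i s t : ℝ) : ℂ) := fun i s =>
    Complex.continuous_ofReal.comp ((hKc i).comp (by fun_prop : Continuous fun t => (s, t)))
  have hbd : ∀ i, ∃ C : ℝ, 0 ≤ C ∧ ∀ x ∈ Icc (s - 1) (s + 1), ∀ t, 0 < t →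
      ‖w t * (K i x t : ℂ)‖ ≤ C * ‖w t‖ := by
    intro i
    obtain ⟨C, hC⟩ := ((isCompact_Icc (a := s - 1) (b := s + 1)).prod
      (isCompact_Icc (a := (0 : ℝ)) (b := R))).exists_bound_of_continuousOn
      (hKc i).continuousOn
    refine ⟨max C 0, le_max_right _ _, fun x hx t ht => ?_⟩
    rcases le_or_gt t R with h | h
    · rw [norm_mul, mul_comm, Complex.norm_real]
      gcongr
      exact le_max_of_le_left (hC (x, t) ⟨hx, ht.le, h⟩)
    · have : w t = 0 := by
        simp only [hwdef]
        rw [hsupp _ (by rwa [Real.coe_toNNReal t ht.le]), mul_zero]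
      simp [this]
  have hmeas : ∀ i x, AEStronglyMeasurable (fun t => w t * (K i x t : ℂ))
      (volume.restrict (Ioi 0)) := fun i x =>
    hw.aestronglyMeasurable.mul (hKc1 i x).aestronglyMeasurable
  obtain ⟨C, hC, hCb⟩ := hbd (i + 1)
  obtain ⟨C', hC', hCb'⟩ := hbd i
  refine (hasDerivAt_integral_of_dominated_loc_of_deriv_le (𝕜 := ℝ)
    (μ := volume.restrict (Ioi 0)) (s := Icc (s - 1) (s + 1)) (x₀ := s)
    (bound := fun t => C * ‖w t‖)
    (F := fun x t => w t * (K i x t : ℂ)) (F' := fun x t => w t * (K (i + 1) x t : ℂ))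
    (Icc_mem_nhds (by linarith) (by linarith)) (.of_forall fun x => hmeas i x) ?_
    (hmeas (i + 1) s) ?_ (hw.norm.const_mul C) ?_).2
  · refine (hw.norm.const_mul C').mono' (hmeas i s) ?_
    filter_upwards [ae_restrict_mem measurableSet_Ioi] with t ht
    exact hCb' s ⟨by linarith, by linarith⟩ t ht
  · filter_upwards [ae_restrict_mem measurableSet_Ioi] with t ht x hx
    exact hCb x hx t ht
  · refine .of_forall fun t x _ => ?_
    have hin : HasDerivAt (fun x : ℝ => Real.pi ^ 2 * t ^ 2 * x) (Real.pi ^ 2 * t ^ 2) x := by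
      simpa using (hasDerivAt_id x).const_mul (Real.pi ^ 2 * t ^ 2)
    have h := ((((hasDerivAt_bess (hν i) (Real.pi ^ 2 * t ^ 2 * x)).comp x hin).const_mul
      (2 * Real.pi ^ ((d : ℝ) / 2) * (-(Real.pi ^ 2 * t ^ 2)) ^ i)).ofReal_comp).const_mul (w t)
    refine h.congr_deriv ?_
    simp only [hK]
    congr 2
    have e1 : (d : ℝ) / 2 - 1 + i + 1 = (d : ℝ) / 2 - 1 + (i + 1 : ℕ) := by push_cast; ring
    rw [e1]
    ring

theorem A_eq_Aext {d : ℕ} (hd : 1 ≤ d) (φ : ℝ≥0 → ℂ) {s : ℝ} (hs : 0 ≤ s) :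
    A d φ s = Aext d φ 0 s := by
  rw [A, Aext, ← integral_const_mul]
  refine setIntegral_congr_fun measurableSet_Ioi fun t ht => ?_
  have ht0 : (0 : ℝ) < t := ht
  have hπ := Real.pi_pos
  have e1 : Lam ((d : ℝ) / 2 - 1) t s * t ^ ((d : ℝ) / 2) =
      Real.pi ^ ((d : ℝ) / 2) / Real.pi * t ^ (d - 1) *
        bess ((d : ℝ) / 2 - 1) (Real.pi ^ 2 * t ^ 2 * s) := by
    rw [Lam_eq ht0 hs, Real.mul_rpow hπ.le ht0.le, Real.rpow_sub_one hπ.ne']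
    have : t ^ ((d : ℝ) / 2 - 1) * t ^ ((d : ℝ) / 2) = t ^ (d - 1) := by
      rw [← Real.rpow_add ht0, ← Real.rpow_natCast]
      congr 1
      rw [Nat.cast_sub hd]; push_cast; ring
    rw [← this]; ring
  simp only [e1, pow_zero, Nat.cast_zero, add_zero, mul_one]
  push_cast
  have : (Real.pi : ℂ) ≠ 0 := Complex.ofReal_ne_zero.mpr hπ.ne'
  field_simp

/-- The link between the theorem's two sides: partial sums and partial integrals both sample one
function of `|ξ|²`. -/
theorem fourier_radial {d : ℕ} (hd : 1 ≤ d) {φ : ℝ≥0 → ℂ} (hi : Integrable (radial d φ))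
    (ξ : E d) : 𝓕 (radial d φ) ξ = Aext d φ 0 (‖ξ‖ ^ 2) := by
  have hr : ∀ x : E d, radial d φ x = φ (‖x‖ : ℝ).toNNReal := fun x => by
    simp only [radial]
    congr 1
    ext; simp
  have h1 : 𝓕 (radial d φ) ξ = ∫ x : E d, φ (‖x‖ : ℝ).toNNReal * e x (-ξ) := by
    rw [Real.fourier_eq']
    refine integral_congr_ae (.of_forall fun x => ?_)
    simp only [hr, e, smul_eq_mul, inner_neg_right]
    rw [mul_comm]
    congr 2
    push_cast; ring
  rw [h1, integral_radial_mul_e hd (ψ := fun t : ℝ => φ t.toNNReal)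
    (hi.congr (.of_forall hr)), norm_neg, Aext]
  refine integral_congr_ae (.of_forall fun t => ?_)
  simp only [pow_zero, Nat.cast_zero, add_zero, mul_one]
  rw [show Real.pi ^ 2 * ‖ξ‖ ^ 2 * t ^ 2 = Real.pi ^ 2 * t ^ 2 * ‖ξ‖ ^ 2 by ring]
  push_cast
  ring

theorem iteratedDeriv_of_hasDerivAt_succ {a : ℕ → ℝ → ℂ}
    (ha : ∀ i s, HasDerivAt (a i) (a (i + 1) s) s) (i : ℕ) : iteratedDeriv i (a 0) = a i := by
  induction i with
  | zero => exact iteratedDeriv_zero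
  | succ i ih =>
    rw [iteratedDeriv_succ, ih]
    exact funext fun s => (ha i s).deriv

theorem contDiff_of_hasDerivAt_succ {a : ℕ → ℝ → ℂ}
    (ha : ∀ i s, HasDerivAt (a i) (a (i + 1) s) s) : ContDiff ℝ ∞ (a 0) := by
  refine contDiff_of_differentiable_iteratedDeriv fun i _ => ?_
  rw [iteratedDeriv_of_hasDerivAt_succ ha]
  exact fun s => (ha i s).differentiableAt

theorem contDiffOn_A {d : ℕ} (hd : 1 ≤ d) {φ : ℝ≥0 → ℂ} (hφ : HasCompactSupport φ)
    (hi : Integrable (radial d φ)) : ContDiffOn ℝ ∞ (A d φ) (Ici 0) :=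
  (contDiff_of_hasDerivAt_succ (hasDerivAt_Aext hd hφ hi)).contDiffOn.congr
    fun _ hs => A_eq_Aext hd φ hs

/-- `Aext d φ 0` is smooth on the whole line, so its one-sided derivatives on `[0,∞)` are ordinary
ones, also at `0`. -/
theorem Aderiv_eq_Aext {d : ℕ} (hd : 1 ≤ d) {φ : ℝ≥0 → ℂ} (hφ : HasCompactSupport φ)
    (hi : Integrable (radial d φ)) (i : ℕ) {s : ℝ} (hs : 0 ≤ s) :
    Aderiv d φ i s = Aext d φ i s := by
  have ha := hasDerivAt_Aext hd hφ hi
  have heq : EqOn (A d φ) (Aext d φ 0) (Ici 0) := fun _ hs => A_eq_Aext hd φ hs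
  rw [Aderiv, iteratedDerivWithin_congr heq hs,
    iteratedDerivWithin_eq_iteratedDeriv (uniqueDiffOn_Ici 0)
      ((contDiff_of_hasDerivAt_succ ha).contDiffAt.of_le (by exact_mod_cast le_top)) hs,
    iteratedDeriv_of_hasDerivAt_succ ha]

/-! ### The lattice, the torus, periodization and Fourier series. -/

theorem latt_apply {d : ℕ} (m : Fin d → ℤ) (i : Fin d) : latt m i = m i := rfl

theorem latt_injective {d : ℕ} : Function.Injective (latt (d := d)) := by
  intro m n h
  funext i
  have := congrArg (fun v : E d => v i) h
  simpa [latt_apply] using this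

theorem latt_add {d : ℕ} (m n : Fin d → ℤ) : latt (m + n) = latt m + latt n := by
  ext i; simp [latt_apply]

theorem latt_zero {d : ℕ} : latt (0 : Fin d → ℤ) = 0 := by
  ext i; simp [latt_apply]

theorem inner_latt_latt {d : ℕ} (m n : Fin d → ℤ) :
    ∃ k : ℤ, (inner ℝ (latt m) (latt n) : ℝ) = k := by
  refine ⟨∑ i, m i * n i, ?_⟩
  simp [PiLp.inner_apply, latt_apply, mul_comm]

theorem e_add_right {d : ℕ} (ξ x y : E d) : e ξ (x + y) = e ξ x * e ξ y := by
  rw [e, e, e, ← Complex.exp_add, inner_add_right]; congr 1; push_cast; ring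

theorem e_comm {d : ℕ} (ξ x : E d) : e ξ x = e x ξ := by
  rw [e, e, real_inner_comm]

theorem e_neg_latt_latt {d : ℕ} (m n : Fin d → ℤ) : e (-latt m) (latt n) = 1 := by
  obtain ⟨k, hk⟩ := inner_latt_latt m n
  rw [e, inner_neg_left, hk, Complex.exp_eq_one_iff]
  exact ⟨-k, by push_cast; ring⟩

theorem fourier_eq_integral_mul_e {d : ℕ} (F : E d → ℂ) (ξ : E d) :
    𝓕 F ξ = ∫ x, F x * e (-ξ) x := by
  rw [Real.fourier_eq']
  refine integral_congr_ae (.of_forall fun x => ?_)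
  simp only [e, smul_eq_mul, inner_neg_left]
  rw [mul_comm, real_inner_comm]
  congr 2
  push_cast; ring

theorem measurableSet_torus (d : ℕ) : MeasurableSet (torus d) := by
  have : torus d = ⋂ i, (fun x : E d => x i) ⁻¹' Ioc (-(1 / 2) : ℝ) (1 / 2) := by
    ext x; simp [torus]
  rw [this]
  exact MeasurableSet.iInter fun i => measurableSet_Ioc.preimage (by fun_prop)

theorem norm_le_of_mem_torus {d : ℕ} {x : E d} (hx : x ∈ torus d) : ‖x‖ ≤ d := by
  rw [EuclideanSpace.norm_eq]
  refine (Real.sqrt_le_sqrt (Finset.sum_le_card_nsmul _ _ 1 fun i _ => ?_)).trans ?_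
  · have := hx i
    rw [Real.norm_eq_abs, sq_abs]
    nlinarith [this.1, this.2]
  · simp only [Finset.card_univ, Fintype.card_fin, nsmul_eq_mul, mul_one]
    rw [Real.sqrt_le_left (by positivity)]
    rcases Nat.eq_zero_or_pos d with rfl | h
    · simp
    · have : (1 : ℝ) ≤ d := by exact_mod_cast h
      nlinarith

/-- Translates of the torus by lattice vectors tile the space. -/
theorem existsUnique_sub_latt_mem_torus {d : ℕ} (x : E d) :
    ∃! m : Fin d → ℤ, x - latt m ∈ torus d := by
  have h : ∀ i, ∃! k : ℤ, x i - k ∈ Ioc (-(1 / 2) : ℝ) (1 / 2) := by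
    intro i
    have := existsUnique_sub_zsmul_mem_Ioc (one_pos (α := ℝ)) (x i) (-(1 / 2))
    rw [show (-(1 / 2) : ℝ) + 1 = 1 / 2 by norm_num] at this
    simpa only [zsmul_eq_mul, mul_one] using this
  choose k hk hu using h
  exact ⟨k, fun i => hk i, fun m hm => funext fun i => hu i (m i) (hm i)⟩

theorem hasSum_setIntegral_torus {d : ℕ} {F : E d → ℂ} (hF : Integrable F) :
    HasSum (fun n : Fin d → ℤ => ∫ x in torus d, F (x + latt n)) (∫ x, F x) := by
  have hm : ∀ n : Fin d → ℤ, MeasurableSet ((fun x : E d => x - latt n) ⁻¹' torus d) := fun n =>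
    (measurableSet_torus d).preimage (by fun_prop)
  have hU : (⋃ n : Fin d → ℤ, (fun x : E d => x - latt n) ⁻¹' torus d) = univ :=
    eq_univ_of_forall fun x => by
      obtain ⟨m, hm, _⟩ := existsUnique_sub_latt_mem_torus x
      exact mem_iUnion.mpr ⟨m, hm⟩
  have h := hasSum_integral_iUnion (μ := (volume : Measure (E d))) (f := F) hm ?_ hF.integrableOn
  · rw [hU, setIntegral_univ] at h
    refine h.congr_fun fun n => ?_
    have hmp : MeasurePreserving (fun x : E d => x + latt n) volume volume :=
      measurePreserving_add_right _ _
    have hemb : MeasurableEmbedding (fun x : E d => x + latt n) :=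
      (MeasurableEquiv.addRight (latt n)).measurableEmbedding
    rw [← hmp.setIntegral_preimage_emb hemb F]
    congr 2
    ext x; simp
  · intro m n hmn
    rw [Function.onFun, Set.disjoint_left]
    intro x hx hx'
    exact hmn ((existsUnique_sub_latt_mem_torus x).unique hx hx')

/-- One finite index set serves all `‖x‖ ≤ M`, so integrability, continuity and integration pass
through the sum with no convergence question. The `+ 1` gives the strict `R < ‖x + m‖`. -/
theorem periodization_eq_sum {d : ℕ} {F : E d → ℂ} {R M : ℝ} (hF : ∀ x, R < ‖x‖ → F x = 0)
    {x : E d} (hx : ‖x‖ ≤ M) :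
    periodization F x = ∑ m ∈ (finite_norm_lt d (R + M + 1)).toFinset, F (x + latt m) := by
  refine tsum_eq_sum fun m hm => hF _ ?_
  simp only [Finite.mem_toFinset, mem_ofPred_eq, not_lt] at hm
  have := norm_sub_norm_le (latt m) (-x)
  rw [norm_neg, sub_neg_eq_add, add_comm] at this
  rw [add_comm] at this ⊢
  linarith

theorem periodization_add_latt {d : ℕ} (F : E d → ℂ) (x : E d) (n : Fin d → ℤ) :
    periodization F (x + latt n) = periodization F x := by
  rw [periodization, periodization, ← (Equiv.addLeft n).tsum_eq (fun m => F (x + latt m))]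
  refine tsum_congr fun m => ?_
  simp [latt_add, add_assoc]

theorem integrableOn_periodization {d : ℕ} {F : E d → ℂ} {R : ℝ} (hF : ∀ x, R < ‖x‖ → F x = 0)
    (hi : Integrable F) : IntegrableOn (periodization F) (torus d) := by
  refine IntegrableOn.congr_fun (f := fun x =>
    ∑ m ∈ (finite_norm_lt d (R + d + 1)).toFinset, F (x + latt m)) ?_
    (fun x hx => (periodization_eq_sum hF (norm_le_of_mem_torus hx)).symm) (measurableSet_torus d)
  exact integrable_finsetSum _ fun m _ => (hi.comp_add_right (latt m)).integrableOn

/-- Unfolding: `e (-latt m)` is lattice-periodic, so the torus integrals of the translates add up to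
the integral over `ℝ^d`. -/
theorem fourierCoefficient_periodization {d : ℕ} {F : E d → ℂ} {R : ℝ}
    (hF : ∀ x, R < ‖x‖ → F x = 0) (hi : Integrable F) (m : Fin d → ℤ) :
    fourierCoefficient (periodization F) m = 𝓕 F (latt m) := by
  have hc : Continuous fun x : E d => e (-latt m) x := by unfold e; fun_prop
  have hG : Integrable fun x => F x * e (-latt m) x :=
    hi.mul_bdd (c := 1) hc.aestronglyMeasurable (.of_forall fun x => (norm_e _ _).le)
  have hper : ∀ (x : E d) n, e (-latt m) (x + latt n) = e (-latt m) x := fun x n => by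
    rw [e_add_right, e_neg_latt_latt, mul_one]
  have h := hasSum_setIntegral_torus hG
  rw [fourier_eq_integral_mul_e, fourierCoefficient]
  refine HasSum.unique ?_ h
  set T := (finite_norm_lt d (R + d + 1)).toFinset
  have h1 : ∫ x in torus d, periodization F x * e (-latt m) x =
      ∑ n ∈ T, ∫ x in torus d, F (x + latt n) * e (-latt m) (x + latt n) := by
    rw [← integral_finsetSum _ fun n _ => (hG.comp_add_right (latt n)).integrableOn]
    refine setIntegral_congr_fun (measurableSet_torus d) fun x hx => ?_
    simp only [hper]
    rw [periodization_eq_sum hF (norm_le_of_mem_torus hx), Finset.sum_mul]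
  rw [h1]
  refine hasSum_sum_of_ne_finset_zero fun n hn => ?_
  refine (setIntegral_congr_fun (measurableSet_torus d) (g := fun _ => (0 : ℂ))
    fun x hx => ?_).trans (by simp)
  have : F (x + latt n) = 0 := by
    refine hF _ ?_
    simp only [T, Finite.mem_toFinset, mem_ofPred_eq, not_lt] at hn
    have h2 := norm_sub_norm_le (latt n) (-x)
    have h3 := norm_le_of_mem_torus hx
    rw [norm_neg, sub_neg_eq_add, add_comm (latt n) x] at h2
    linarith
  simp [this]

theorem continuous_periodization {d : ℕ} {F : E d → ℂ} {R : ℝ} (hF : ∀ x, R < ‖x‖ → F x = 0)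
    (hc : Continuous F) : Continuous (periodization F) := by
  refine continuous_iff_continuousAt.mpr fun x => ?_
  have h : (fun y => ∑ m ∈ (finite_norm_lt d (R + (‖x‖ + 1) + 1)).toFinset, F (y + latt m))
      =ᶠ[nhds x] periodization F := by
    filter_upwards [Metric.ball_mem_nhds x one_pos] with y hy
    refine (periodization_eq_sum hF ?_).symm
    have := norm_sub_norm_le y x
    rw [mem_ball_iff_norm] at hy
    linarith
  refine ContinuousAt.congr ?_ h
  exact Continuous.continuousAt (continuous_finsetSum _ fun m _ => by fun_prop)

theorem mFourier_coe {d : ℕ} (m : Fin d → ℤ) (x : E d) :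
    UnitAddTorus.mFourier m (fun i => ((x i : ℝ) : UnitAddCircle)) = e (latt m) x := by
  simp only [UnitAddTorus.mFourier, ContinuousMap.coe_mk, fourier_coe_apply, e]
  rw [← Complex.exp_sum]
  congr 1
  simp only [PiLp.inner_apply, latt_apply]
  push_cast
  rw [Finset.mul_sum]
  refine Finset.sum_congr rfl fun i _ => ?_
  simp
  ring

/-- A continuous function on the torus with summable Fourier coefficients is the sum of its Fourier
series, for functions given as lattice-periodic functions on `ℝ^d`. -/
theorem hasSum_fourierCoefficient {d : ℕ} {P : E d → ℂ} (hP : Continuous P)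
    (hper : ∀ x n, P (x + latt n) = P x) (hs : Summable (fourierCoefficient P)) :
    HasSum (fourierCoefficient P) (P 0) := by
  have hlift : ∀ z : UnitAddTorus (Fin d), ∃ x : E d, (fun i => ((x i : ℝ) : UnitAddCircle)) = z :=
    fun z => by
      choose y hy using fun i => QuotientAddGroup.mk_surjective (z i)
      exact ⟨WithLp.toLp 2 y, funext hy⟩
  have hwd : ∀ x y : E d, (fun i => ((x i : ℝ) : UnitAddCircle)) = (fun i => ((y i : ℝ) :
      UnitAddCircle)) → P x = P y := by
    intro x y hxy
    have h : ∀ i, ∃ k : ℤ, x i = y i + k := fun i => by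
      have := congrFun hxy i
      rw [← sub_eq_zero, ← AddCircle.coe_sub, AddCircle.coe_eq_zero_iff] at this
      obtain ⟨k, hk⟩ := this
      exact ⟨k, by rw [zsmul_eq_mul, mul_one] at hk; linarith⟩
    choose k hk using h
    have : x = y + latt k := by ext i; simp [hk i, latt_apply]
    rw [this, hper]
  -- The section `r` need not be continuous; `hwd` makes `P ∘ r` independent of it, and continuity
  -- descends through the quotient map.
  choose r hr using hlift
  set f : UnitAddTorus (Fin d) → ℂ := fun z => P (r z) with hf
  have hfx : ∀ x : E d, f (fun i => ((x i : ℝ) : UnitAddCircle)) = P x := fun x => hwd _ _ (hr _)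
  have hq : IsOpenQuotientMap (Pi.map fun (_ : Fin d) (t : ℝ) => (t : UnitAddCircle)) :=
    IsOpenQuotientMap.piMap fun _ => QuotientAddGroup.isOpenQuotientMap_mk
  have hfc : Continuous f := by
    rw [hq.isQuotientMap.continuous_iff]
    have : f ∘ (Pi.map fun (_ : Fin d) (t : ℝ) => (t : UnitAddCircle)) =
        fun y => P (WithLp.toLp 2 y) := funext fun y => hfx (WithLp.toLp 2 y)
    rw [this]
    exact hP.comp (PiLp.continuous_toLp 2 _)
  have hcoef : ∀ m, UnitAddTorus.mFourierCoeff f m = fourierCoefficient P m := by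
    intro m
    rw [UnitAddTorus.mFourierCoeff_eq_integral f m (fun _ => -(1 / 2)), fourierCoefficient]
    have hmp := (PiLp.volume_preserving_toLp (Fin d))
    rw [← hmp.setIntegral_preimage_emb (MeasurableEquiv.toLp 2 _).measurableEmbedding]
    have hset : {x : Fin d → ℝ | ∀ i, x i ∈ Ioc (-(1 / 2) : ℝ) (-(1 / 2) + 1)} =
        WithLp.toLp 2 ⁻¹' torus d := by
      ext x
      simp only [torus, mem_ofPred_eq, mem_preimage]
      rw [show (-(1 / 2) : ℝ) + 1 = 1 / 2 by norm_num]
    rw [hset]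
    refine integral_congr_ae (.of_forall fun x => ?_)
    have h1 := mFourier_coe (-m) (WithLp.toLp 2 x)
    have h2 := hfx (WithLp.toLp 2 x)
    have h3 : latt (-m) = -latt m := by ext i; simp [latt_apply]
    simp only at h1 h2
    rw [h3] at h1
    simp only [smul_eq_mul]
    rw [h1, h2, mul_comm]
  have hfs : Summable (UnitAddTorus.mFourierCoeff (⟨f, hfc⟩ : C(UnitAddTorus (Fin d), ℂ))) :=
    hs.congr fun m => (hcoef m).symm
  have h := UnitAddTorus.hasSum_mFourier_series_apply_of_summable hfs
    (fun i => (((0 : E d) i : ℝ) : UnitAddCircle))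
  have h0 : (⟨f, hfc⟩ : C(UnitAddTorus (Fin d), ℂ)) (fun i => (((0 : E d) i : ℝ) : UnitAddCircle))
      = P 0 := hfx 0
  rw [h0] at h
  refine h.congr_fun fun m => ?_
  rw [mFourier_coe, e, inner_zero_right]
  simpa using (hcoef m).symm

/-! ### Poisson summation for Riesz means. -/

theorem summable_norm_sub_latt_rpow {d : ℕ} {p : ℝ} (hp : (d : ℝ) < p) (x : E d) :
    Summable fun m : Fin d → ℤ => ‖x - latt m‖ ^ (-p) := by
  set b := (EuclideanSpace.basisFun (Fin d) ℝ).toBasis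
  set Λ : Submodule ℤ (E d) := Submodule.span ℤ (range b)
  have hrank : Module.finrank ℤ Λ = d := by
    rw [ZLattice.rank ℝ Λ]; simp
  have h := ZLattice.summable_norm_sub_rpow Λ (-p) (by rw [hrank]; linarith) x
  have hmem : ∀ m : Fin d → ℤ, latt m ∈ Λ := fun m => by
    have : latt m = ∑ i, m i • b i := by
      ext j
      simp [b, latt_apply, Finset.sum_apply, Pi.single_apply]
    rw [this]
    exact Submodule.sum_mem _ fun i _ => Submodule.smul_mem _ _ (Submodule.subset_span ⟨i, rfl⟩)
  have hinj : Function.Injective fun m : Fin d → ℤ => (⟨latt m, hmem m⟩ : Λ) := fun m n hmn =>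
    latt_injective (congrArg Subtype.val hmn)
  refine (h.comp_injective hinj).congr fun m => ?_
  simp [norm_sub_rev x]

theorem sub_latt_ne_zero {d : ℕ} {x : E d} (hx : x ∈ torus d) {m : Fin d → ℤ} (hm : m ≠ 0) :
    x - latt m ≠ 0 := by
  intro h
  refine hm ((existsUnique_sub_latt_mem_torus x).unique ?_ ?_)
  · rw [h]; intro i; simp
  · simpa [latt_zero] using hx

/-- The decay estimate excludes `y = 0`, but `x - latt m` vanishes for at most one `m`. -/
theorem summable_Dint {d : ℕ} (hd : 1 ≤ d) {k : ℕ} (hk : (d : ℝ) < d / 2 + k) {s : ℝ} (hs : 0 ≤ s)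
    (x : E d) : Summable fun m : Fin d → ℤ => Dint k s (x - latt m) := by
  obtain ⟨C, _, hb⟩ := exists_Dint_decay hd k s
  refine Summable.of_norm_bounded_eventually ((summable_norm_sub_latt_rpow hk x).mul_left C) ?_
  have hfin : {m : Fin d → ℤ | x - latt m = 0}.Finite := by
    refine Set.Subsingleton.finite fun m hm n hn => latt_injective ?_
    rw [← sub_eq_zero.mp hm, ← sub_eq_zero.mp hn]
  filter_upwards [hfin.compl_mem_cofinite] with m hm
  exact hb s ⟨hs, le_rfl⟩ _ hm

theorem Dsum_natCast {d : ℕ} (k : ℕ) (s : ℝ) (x : E d) :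
    Dsum k s x = ∑ m ∈ (finite_norm_sq_lt d s).toFinset,
      (((s - ‖latt m‖ ^ 2) ^ k / (Nat.factorial k : ℝ) : ℝ) : ℂ) * e (latt m) x := by
  rw [Dsum, Real.Gamma_nat_eq_factorial, Finset.mul_sum]
  refine Finset.sum_congr rfl fun m _ => ?_
  rw [Real.rpow_natCast]
  push_cast
  ring

/-- The truncated power `(s - v)_+^k / k!`. -/
def tpow (k : ℕ) (s v : ℝ) : ℝ := max (s - v) 0 ^ k / (Nat.factorial k : ℝ)

theorem tpow_of_lt {k : ℕ} {s v : ℝ} (h : v < s) :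
    tpow k s v = (s - v) ^ k / (Nat.factorial k : ℝ) := by
  rw [tpow, max_eq_left (by linarith)]

theorem tpow_of_le {k : ℕ} (hk : k ≠ 0) {s v : ℝ} (h : s ≤ v) : tpow k s v = 0 := by
  rw [tpow, max_eq_right (by linarith), zero_pow hk, zero_div]

/-- Frees the index set from `s`, so that continuity and integration in `s` act on a fixed finite
sum. For `k = 0` the convention `0 ^ 0 = 1` would spoil the truncation. -/
theorem Dsum_eq_sum_tpow {d : ℕ} {k : ℕ} (hk : k ≠ 0) {s L : ℝ} (hs : s ≤ L) (x : E d) :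
    Dsum k s x = ∑ m ∈ (finite_norm_sq_lt d L).toFinset,
      ((tpow k s (‖latt m‖ ^ 2) : ℝ) : ℂ) * e (latt m) x := by
  rw [Dsum_natCast]
  refine (Finset.sum_congr rfl fun m hm => ?_).trans (Finset.sum_subset ?_ fun m _ hm => ?_)
  · rw [tpow_of_lt (by simpa using hm)]
  · intro m hm
    simp only [Finite.mem_toFinset, mem_ofPred_eq] at hm ⊢
    linarith
  · rw [tpow_of_le hk (by simpa using hm), Complex.ofReal_zero, zero_mul]

theorem Dint_eq_setIntegral_tpow {d : ℕ} {k : ℕ} (hk : k ≠ 0) {s L : ℝ} (hs : s ≤ L) (y : E d) :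
    Dint k s y = ∫ ξ in {ξ : E d | ‖ξ‖ ^ 2 < L}, ((tpow k s (‖ξ‖ ^ 2) : ℝ) : ℂ) * e ξ y := by
  rw [Dint_natCast, ← integral_indicator (measurableSet_norm_sq_lt s),
    ← integral_indicator (measurableSet_norm_sq_lt L)]
  refine integral_congr_ae (.of_forall fun ξ => ?_)
  simp only [indicator, mem_ofPred_eq]
  by_cases h : ‖ξ‖ ^ 2 < s
  · rw [if_pos h, if_pos (h.trans_le hs), tpow_of_lt h]
  · rw [if_neg h, tpow_of_le hk (not_lt.mp h)]
    simp

theorem Dint_eq_integral_tpow {d : ℕ} {k : ℕ} (hk : k ≠ 0) (s : ℝ) (y : E d) :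
    Dint k s y = ∫ ξ : E d, ((tpow k s (‖ξ‖ ^ 2) : ℝ) : ℂ) * e ξ y := by
  rw [Dint_eq_setIntegral_tpow hk le_rfl]
  refine setIntegral_eq_integral_of_forall_compl_eq_zero fun ξ hξ => ?_
  rw [tpow_of_le hk (by simpa using hξ), Complex.ofReal_zero, zero_mul]

theorem continuous_tpow (k : ℕ) : Continuous fun p : ℝ × ℝ => tpow k p.1 p.2 := by
  unfold tpow; fun_prop

/-- Poisson summation for Riesz means. -/
theorem hasSum_Dint {d : ℕ} (hd : 1 ≤ d) {k : ℕ} (hk0 : k ≠ 0) (hk : (d : ℝ) < d / 2 + k)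
    {s : ℝ} (hs : 0 ≤ s) (x : E d) :
    HasSum (fun m : Fin d → ℤ => Dint k s (x - latt m)) (Dsum k s x) := by
  -- The point `x` sits in the character: the Fourier transform of `G` at `m` is `𝒟_k(s:x-m)`, and
  -- the periodization of `G` at `0` is `D_k(s:x)`.
  set G : E d → ℂ := fun ξ => ((tpow k s (‖ξ‖ ^ 2) : ℝ) : ℂ) * e ξ x with hG
  have hGc : Continuous G := by
    have h1 := continuous_e_left x
    have h2 : Continuous fun ξ : E d => tpow k s (‖ξ‖ ^ 2) :=
      (continuous_tpow k).comp (by fun_prop : Continuous fun ξ : E d => (s, ‖ξ‖ ^ 2))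
    fun_prop
  have hG0 : ∀ ξ : E d, s ≤ ‖ξ‖ ^ 2 → G ξ = 0 := fun ξ h => by
    simp only [hG]
    rw [tpow_of_le hk0 h, Complex.ofReal_zero, zero_mul]
  have hsupp : ∀ ξ : E d, Real.sqrt s < ‖ξ‖ → G ξ = 0 := fun ξ h =>
    hG0 ξ ((Real.sqrt_le_left (norm_nonneg ξ)).mp h.le)
  have hGi : Integrable G := by
    refine (integrableOn_iff_integrable_of_support_subset ?_).mp
      (hGc.continuousOn.integrableOn_compact (isCompact_closedBall (0 : E d) (Real.sqrt s)))
    intro ξ hξ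
    rw [mem_closedBall_zero_iff]
    by_contra h
    exact hξ (hsupp ξ (not_le.mp h))
  have hcoef : ∀ m, fourierCoefficient (periodization G) m = Dint k s (x - latt m) := by
    intro m
    rw [fourierCoefficient_periodization hsupp hGi, fourier_eq_integral_mul_e,
      Dint_eq_integral_tpow hk0]
    refine integral_congr_ae (.of_forall fun ξ => ?_)
    simp only [hG]
    rw [sub_eq_add_neg, e_add_right, e_comm (-latt m)]
    ring
  have h0 : periodization G 0 = Dsum k s x := by
    rw [periodization, Dsum_eq_sum_tpow hk0 le_rfl,
      tsum_eq_sum (s := (finite_norm_sq_lt d s).toFinset)]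
    · simp only [zero_add, hG]
    · intro m hm
      rw [zero_add]
      exact hG0 _ (by simpa using hm)
  have h := hasSum_fourierCoefficient (continuous_periodization hsupp hGc)
    (fun y n => periodization_add_latt G y n)
    ((summable_Dint hd hk hs x).congr fun m => (hcoef m).symm)
  rw [h0] at h
  exact h.congr_fun fun m => (hcoef m).symm

theorem hasSum_Dint_ne_zero {d : ℕ} (hd : 1 ≤ d) {k : ℕ} (hk0 : k ≠ 0) (hk : (d : ℝ) < d / 2 + k)
    {s : ℝ} (hs : 0 ≤ s) (x : E d) :
    HasSum (fun m : {m : Fin d → ℤ // m ≠ 0} => Dint k s (x - latt m.1)) (Delta k s x) := by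
  have h := hasSum_ite_sub_hasSum (hasSum_Dint hd hk0 hk hs x) 0
  rw [latt_zero, sub_zero] at h
  refine (hasSum_subtype_iff_indicator (s := {m : Fin d → ℤ | m ≠ 0})
    (f := fun m => Dint k s (x - latt m))).mpr (h.congr_fun fun m => ?_)
  by_cases hm : m = 0 <;> simp [hm, indicator]

/-! ### Taylor expansion summed over lattice points and integrated over the ball. -/

/-- Taylor expansion at `L`, with the remainder written as an integral over `[0,L]`. -/
theorem taylor_tpow {a : ℕ → ℝ → ℂ} (ha : ∀ i s, HasDerivAt (a i) (a (i + 1) s) s) {k : ℕ}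
    (hk : k ≠ 0) {v L : ℝ} (hv : 0 ≤ v) (hvL : v ≤ L) :
    a 0 v = ∑ j ∈ Finset.range (k + 1), (-1) ^ j *
        (((L - v) ^ j / (Nat.factorial j : ℝ) : ℝ) : ℂ) * a j L
      + (-1) ^ (k + 1) * ∫ s in (0 : ℝ)..L, ((tpow k s v : ℝ) : ℂ) * a (k + 1) s := by
  have hc : ∀ i, Continuous (a i) := fun i =>
    continuous_iff_continuousAt.mpr fun s => (ha i s).continuousAt
  have main : ∀ k : ℕ, a 0 v = ∑ j ∈ Finset.range (k + 1), (-1) ^ j *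
        (((L - v) ^ j / (Nat.factorial j : ℝ) : ℝ) : ℂ) * a j L
      + (-1) ^ (k + 1) * ∫ s in v..L,
        (((s - v) ^ k / (Nat.factorial k : ℝ) : ℝ) : ℂ) * a (k + 1) s := by
    intro k
    induction k with
    | zero =>
      have := intervalIntegral.integral_eq_sub_of_hasDerivAt (a := v) (b := L)
        (fun s _ => ha 0 s) ((hc 1).intervalIntegrable _ _)
      simp only [zero_add, Finset.range_one, Finset.sum_singleton, pow_zero, Nat.factorial_zero,
        Nat.cast_one, div_one, Complex.ofReal_one, one_mul, pow_one]
      rw [this]; ring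
    | succ k ih =>
      have hu : ∀ s : ℝ, HasDerivAt
          (fun s : ℝ => (((s - v) ^ (k + 1) / (Nat.factorial (k + 1) : ℝ) : ℝ) : ℂ))
          (((s - v) ^ k / (Nat.factorial k : ℝ) : ℝ) : ℂ) s := by
        intro s
        have h := ((((hasDerivAt_id s).sub_const v).pow (k + 1)).div_const
          (Nat.factorial (k + 1) : ℝ)).ofReal_comp
        refine h.congr_deriv ?_
        have hf : (Nat.factorial k : ℝ) ≠ 0 := by positivity
        have hk : (k : ℝ) + 1 ≠ 0 := by positivity
        congr 1
        rw [Nat.factorial_succ]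
        push_cast
        simp only [id]
        field_simp
      have hibp := intervalIntegral.integral_mul_deriv_eq_deriv_mul (a := v) (b := L)
        (fun s _ => hu s) (fun s _ => ha (k + 1) s)
        (Continuous.intervalIntegrable (by fun_prop) _ _) ((hc (k + 1 + 1)).intervalIntegrable _ _)
      rw [Finset.sum_range_succ, hibp, ih]
      simp only [sub_self, ne_eq, Nat.add_eq_zero_iff, one_ne_zero, and_false, not_false_eq_true,
        zero_pow, zero_div, Complex.ofReal_zero, zero_mul, sub_zero]
      ring
  -- `tpow` vanishes for `s ≤ v`, so the remainder over `[v,L]` extends to `[0,L]`, a range common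
  -- to all `v`.
  rw [main k]
  congr 2
  have hcont : Continuous fun s => ((tpow k s v : ℝ) : ℂ) * a (k + 1) s := by
    have h2 : Continuous fun s : ℝ => tpow k s v :=
      (continuous_tpow k).comp (by fun_prop : Continuous fun s : ℝ => (s, v))
    have := hc (k + 1)
    fun_prop
  rw [← intervalIntegral.integral_add_adjacent_intervals (hcont.intervalIntegrable 0 v)
    (hcont.intervalIntegrable v L)]
  have h1 : ∫ s in (0 : ℝ)..v, ((tpow k s v : ℝ) : ℂ) * a (k + 1) s = 0 := by
    rw [intervalIntegral.integral_congr (g := fun _ => (0 : ℂ))]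
    · simp
    · intro s hs
      rw [uIcc_of_le hv] at hs
      simp only [tpow_of_le hk hs.2, Complex.ofReal_zero, zero_mul]
  rw [h1, zero_add]
  refine intervalIntegral.integral_congr fun s hs => ?_
  rw [uIcc_of_le hvL] at hs
  simp only [tpow]
  rw [max_eq_left (by linarith [hs.1])]

theorem sum_lattice_taylor {d : ℕ} {a : ℕ → ℝ → ℂ} (ha : ∀ i s, HasDerivAt (a i) (a (i + 1) s) s)
    {k : ℕ} (hk : k ≠ 0) {L : ℝ} (hL : 0 ≤ L) (x : E d) :
    ∑ m ∈ (finite_norm_sq_lt d L).toFinset, a 0 (‖latt m‖ ^ 2) * e (latt m) x =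
      ∑ j ∈ Finset.range (k + 1), (-1) ^ j * Dsum j L x * a j L
      + (-1) ^ (k + 1) * ∫ s in (0 : ℝ)..L, Dsum k s x * a (k + 1) s := by
  have hc : ∀ i, Continuous (a i) := fun i =>
    continuous_iff_continuousAt.mpr fun s => (ha i s).continuousAt
  have hint : ∫ s in (0 : ℝ)..L, Dsum k s x * a (k + 1) s =
      ∑ m ∈ (finite_norm_sq_lt d L).toFinset,
        (∫ s in (0 : ℝ)..L, ((tpow k s (‖latt m‖ ^ 2) : ℝ) : ℂ) * a (k + 1) s) * e (latt m) x := by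
    simp_rw [← intervalIntegral.integral_mul_const]
    rw [← intervalIntegral.integral_finsetSum]
    · refine intervalIntegral.integral_congr fun s hs => ?_
      rw [uIcc_of_le hL] at hs
      rw [Dsum_eq_sum_tpow hk hs.2, Finset.sum_mul]
      exact Finset.sum_congr rfl fun m _ => by ring
    · intro m _
      have h2 : Continuous fun s : ℝ => tpow k s (‖latt m‖ ^ 2) :=
        (continuous_tpow k).comp (by fun_prop : Continuous fun s : ℝ => (s, ‖latt m‖ ^ 2))
      have := hc (k + 1)
      exact Continuous.intervalIntegrable (by fun_prop) _ _
  rw [hint]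
  simp_rw [Dsum_natCast, Finset.mul_sum, Finset.sum_mul]
  rw [Finset.sum_comm, ← Finset.sum_add_distrib]
  refine Finset.sum_congr rfl fun m hm => ?_
  have hm' : ‖latt m‖ ^ 2 < L := by simpa using hm
  rw [taylor_tpow ha hk (sq_nonneg _) hm'.le, add_mul, Finset.sum_mul]
  congr 1
  · exact Finset.sum_congr rfl fun j _ => by ring
  · ring

/-- The continuous twin of `sum_lattice_taylor`: Fubini on a bounded region replaces the exchange of
a finite sum with the `s`-integral. -/
theorem integral_ball_taylor {d : ℕ} {a : ℕ → ℝ → ℂ} (ha : ∀ i s, HasDerivAt (a i) (a (i + 1) s) s)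
    {k : ℕ} (hk : k ≠ 0) {L : ℝ} (hL : 0 ≤ L) (x : E d) :
    ∫ ξ in {ξ : E d | ‖ξ‖ ^ 2 < L}, a 0 (‖ξ‖ ^ 2) * e ξ x =
      ∑ j ∈ Finset.range (k + 1), (-1) ^ j * Dint j L x * a j L
      + (-1) ^ (k + 1) * ∫ s in (0 : ℝ)..L, Dint k s x * a (k + 1) s := by
  have hc : ∀ i, Continuous (a i) := fun i =>
    continuous_iff_continuousAt.mpr fun s => (ha i s).continuousAt
  have hce := continuous_e_left x
  have hck := hc (k + 1)
  set B := {ξ : E d | ‖ξ‖ ^ 2 < L} with hB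
  have hkc : Continuous fun p : E d × ℝ =>
      ((tpow k p.2 (‖p.1‖ ^ 2) : ℝ) : ℂ) * a (k + 1) p.2 * e p.1 x := by
    have h2 : Continuous fun p : E d × ℝ => tpow k p.2 (‖p.1‖ ^ 2) :=
      (continuous_tpow k).comp (by fun_prop : Continuous fun p : E d × ℝ => (p.2, ‖p.1‖ ^ 2))
    fun_prop
  have hprod : Integrable (Function.uncurry fun (ξ : E d) (s : ℝ) =>
      ((tpow k s (‖ξ‖ ^ 2) : ℝ) : ℂ) * a (k + 1) s * e ξ x)
      ((volume.restrict B).prod (volume.restrict (Ioc 0 L))) := by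
    rw [Measure.prod_restrict]
    exact (hkc.continuousOn.integrableOn_compact
      ((isCompact_closedBall (0 : E d) (Real.sqrt L)).prod (isCompact_Icc (a := 0) (b := L)))).mono_set
      (prod_mono (norm_sq_lt_subset_closedBall L) Ioc_subset_Icc_self)
  have hint : ∫ s in (0 : ℝ)..L, Dint k s x * a (k + 1) s = ∫ ξ in B,
      (∫ s in (0 : ℝ)..L, ((tpow k s (‖ξ‖ ^ 2) : ℝ) : ℂ) * a (k + 1) s) * e ξ x := by
    simp_rw [← intervalIntegral.integral_mul_const]
    simp_rw [intervalIntegral.integral_of_le hL]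
    rw [integral_integral_swap hprod]
    refine setIntegral_congr_fun measurableSet_Ioc fun s hs => ?_
    rw [Dint_eq_setIntegral_tpow hk hs.2, ← integral_mul_const]
    exact integral_congr_ae (.of_forall fun ξ => by ring)
  have hint2 : IntegrableOn (fun ξ : E d =>
      (∫ s in (0 : ℝ)..L, ((tpow k s (‖ξ‖ ^ 2) : ℝ) : ℂ) * a (k + 1) s) * e ξ x) B := by
    have := hprod.integral_prod_left
    refine this.congr (.of_forall fun ξ => ?_)
    simp only [Function.uncurry]
    rw [intervalIntegral.integral_of_le hL, ← integral_mul_const]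
  have hint1 : ∀ j : ℕ, IntegrableOn (fun ξ : E d =>
      (((L - ‖ξ‖ ^ 2) ^ j / (Nat.factorial j : ℝ) : ℝ) : ℂ) * e ξ x) B := fun j =>
    integrableOn_norm_sq_lt L (by fun_prop)
  rw [hint]
  simp_rw [Dint_natCast, mul_right_comm _ _ (a _ L), ← integral_const_mul]
  rw [← integral_finsetSum _ fun j _ => (hint1 j).const_mul _, ← integral_add
    (integrable_finsetSum _ fun j _ => (hint1 j).const_mul _) (hint2.const_mul _)]
  refine setIntegral_congr_fun (measurableSet_norm_sq_lt L) fun ξ hξ => ?_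
  rw [taylor_tpow ha hk (sq_nonneg _) (le_of_lt hξ), add_mul, Finset.sum_mul]
  congr 1
  · exact Finset.sum_congr rfl fun j _ => by ring
  · ring

/-! ### Assembling the expansion. -/

theorem lt_half_add_dSharp {d : ℕ} (hd : 1 ≤ d) : (d : ℝ) < d / 2 + (dSharp d + 1 : ℕ) := by
  have : d < 2 * (dSharp d + 1) := by unfold dSharp; omega
  have : (d : ℝ) < 2 * (dSharp d + 1 : ℕ) := by exact_mod_cast this
  linarith

theorem radial_eq_zero {d : ℕ} {φ : ℝ≥0 → ℂ} {R : ℝ} (h : ∀ t : ℝ≥0, R < t → φ t = 0) (x : E d)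
    (hx : R < ‖x‖) : radial d φ x = 0 := h _ (by simpa using hx)

theorem toFinset_norm_sq_lt {d : ℕ} {r : ℝ} (hr : 0 ≤ r) :
    (finite_norm_lt d r).toFinset = (finite_norm_sq_lt d (r ^ 2)).toFinset := by
  ext m
  simp only [Finite.mem_toFinset, mem_ofPred_eq]
  exact (sq_lt_sq₀ (norm_nonneg _) hr).symm

/-- The sum over nonzero lattice points of `∫ 𝒟_k(s:x-m) a_{k+1}(s) ds`. -/
theorem hasSum_integral_Dint_mul {d : ℕ} (hd : 1 ≤ d) {a : ℕ → ℝ → ℂ}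
    (ha : ∀ i s, HasDerivAt (a i) (a (i + 1) s) s) {k : ℕ} (hk : (d : ℝ) < d / 2 + (k + 1 : ℕ))
    {L : ℝ} (hL : 0 ≤ L) {x : E d} (hx : x ∈ torus d) :
    HasSum (fun m : {m : Fin d → ℤ // m ≠ 0} =>
        ∫ s in (0 : ℝ)..L, Dint k s (x - latt m.1) * a (k + 1) s)
      (Delta (k + 1 : ℕ) L x * a (k + 1) L
        - ∫ s in (0 : ℝ)..L, Delta (k + 1 : ℕ) s x * a (k + 2) s) := by
  have hc : ∀ i, Continuous (a i) := fun i =>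
    continuous_iff_continuousAt.mpr fun s => (ha i s).continuousAt
  have hck := hc (k + 2)
  have hsub : uIoc 0 L ⊆ Ici 0 := by
    rw [uIoc_of_le hL]; exact fun s hs => hs.1.le
  obtain ⟨C, hC, hdec⟩ := exists_Dint_decay hd (k + 1) L
  obtain ⟨M, hM⟩ := (isCompact_Icc (a := (0 : ℝ)) (b := L)).exists_bound_of_continuousOn
    hck.continuousOn
  have hM0 : 0 ≤ M := (norm_nonneg _).trans (hM 0 ⟨le_rfl, hL⟩)
  -- A majorant independent of `s`, legitimate for every `m ≠ 0` because `x` lies in the torus and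
  -- so is no nonzero lattice point.
  set bd : {m : Fin d → ℤ // m ≠ 0} → ℝ := fun m =>
    C * ‖x - latt m.1‖ ^ (-((d : ℝ) / 2 + (k + 1 : ℕ))) * M
  have hbd : Summable bd :=
    (((summable_norm_sub_latt_rpow hk x).subtype {m : Fin d → ℤ | m ≠ 0}).mul_left C).mul_right M
  have hpois : ∀ s, 0 ≤ s → HasSum (fun m : {m : Fin d → ℤ // m ≠ 0} =>
      Dint (k + 1 : ℕ) s (x - latt m.1)) (Delta (k + 1 : ℕ) s x) := fun s hs =>
    hasSum_Dint_ne_zero hd (Nat.succ_ne_zero k) hk hs x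
  have h2 := intervalIntegral.hasSum_integral_of_dominated_convergence
    (μ := volume) (a := 0) (b := L)
    (F := fun (m : {m : Fin d → ℤ // m ≠ 0}) s => Dint (k + 1 : ℕ) s (x - latt m.1) * a (k + 2) s)
    (f := fun s => Delta (k + 1 : ℕ) s x * a (k + 2) s) (fun m _ => bd m) ?_ ?_ ?_ ?_ ?_
  -- Term by term this is integration by parts: the boundary values sum by Poisson at `L`, the
  -- integrals by dominated convergence.
  · refine (((hpois L hL).mul_right (a (k + 1) L)).sub h2).congr_fun fun m => ?_
    exact integral_Dint_mul hd k _ hL (ha (k + 1)) hck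
  · intro m
    exact (((continuousOn_Dint hd (k + 1) _).mono hsub).mul
      hck.continuousOn).aestronglyMeasurable measurableSet_uIoc
  · intro m
    refine .of_forall fun s hs => ?_
    rw [uIoc_of_le hL] at hs
    rw [norm_mul]
    exact mul_le_mul (hdec s ⟨hs.1.le, hs.2⟩ _ (sub_latt_ne_zero hx m.2)) (hM s ⟨hs.1.le, hs.2⟩)
      (norm_nonneg _) (by positivity)
  · exact .of_forall fun s _ => hbd
  · exact intervalIntegrable_const
  · exact .of_forall fun s hs => (hpois s (hsub hs)).mul_right _

theorem sphericalSum_eq {d : ℕ} (hd : 1 ≤ d) {φ : ℝ≥0 → ℂ} (hφ : HasCompactSupport φ)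
    (hi : Integrable (radial d φ)) {r : ℝ} (hr : 0 ≤ r) (x : E d) :
    sphericalSum r (periodization (radial d φ)) x =
      ∑ m ∈ (finite_norm_sq_lt d (r ^ 2)).toFinset,
        Aext d φ 0 (‖latt m‖ ^ 2) * e (latt m) x := by
  obtain ⟨R, _, hR⟩ := exists_support_bound hφ
  rw [sphericalSum, toFinset_norm_sq_lt hr]
  refine Finset.sum_congr rfl fun m _ => ?_
  rw [fourierCoefficient_periodization (radial_eq_zero hR) hi, fourier_radial hd hi]

theorem sphericalIntegral_eq {d : ℕ} (hd : 1 ≤ d) {φ : ℝ≥0 → ℂ}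
    (hi : Integrable (radial d φ)) {r : ℝ} (hr : 0 ≤ r) (x : E d) :
    sphericalIntegral r (radial d φ) x =
      ∫ ξ in {ξ : E d | ‖ξ‖ ^ 2 < r ^ 2}, Aext d φ 0 (‖ξ‖ ^ 2) * e ξ x := by
  have : {ξ : E d | ‖ξ‖ < r} = {ξ : E d | ‖ξ‖ ^ 2 < r ^ 2} := by
    ext ξ; exact (sq_lt_sq₀ (norm_nonneg _) hr).symm
  simp only [sphericalIntegral, this, fourier_radial hd hi]

theorem continuousOn_Dsum_and_Dint {d : ℕ} (hd : 1 ≤ d) {k : ℕ} (hk : k ≠ 0) (x : E d) (L : ℝ) :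
    ContinuousOn (fun s => Dsum k s x) (Icc 0 L) ∧ ContinuousOn (fun s => Dint k s x) (Icc 0 L) := by
  refine ⟨?_, (continuousOn_Dint hd k x).mono Icc_subset_Ici_self⟩
  have : Continuous fun s => ∑ m ∈ (finite_norm_sq_lt d L).toFinset,
      ((tpow k s (‖latt m‖ ^ 2) : ℝ) : ℂ) * e (latt m) x := by
    unfold tpow; fun_prop
  exact this.continuousOn.congr fun s hs => Dsum_eq_sum_tpow hk hs.2 x

theorem radial_expansion {d : ℕ} (hd : 1 ≤ d) {φ : ℝ≥0 → ℂ} (hφ : HasCompactSupport φ)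
    (hi : Integrable (radial d φ)) :
    IntegrableOn (periodization (radial d φ)) (torus d) ∧
      ContDiffOn ℝ ∞ (A d φ) (Ici 0) ∧
      ∀ r : ℝ, 0 ≤ r → ∀ x ∈ torus d,
        (∀ m : Fin d → ℤ, IntervalIntegrable
          (fun s => Dint (dSharp d) s (x - latt m) * Aderiv d φ (dSharp d + 1) s)
          volume 0 (r ^ 2)) ∧
        Summable (fun m : {m : Fin d → ℤ // m ≠ 0} =>
          ∫ s in (0 : ℝ)..r ^ 2,
            Dint (dSharp d) s (x - latt m.1) * Aderiv d φ (dSharp d + 1) s) ∧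
        sphericalSum r (periodization (radial d φ)) x =
          sphericalIntegral r (radial d φ) x
          + ∑ j ∈ Finset.range (dSharp d + 1),
              (-1) ^ j * Delta j (r ^ 2) x * Aderiv d φ j (r ^ 2)
          + (-1) ^ (dSharp d + 1) * ∑' m : {m : Fin d → ℤ // m ≠ 0},
              ∫ s in (0 : ℝ)..r ^ 2,
                Dint (dSharp d) s (x - latt m.1) * Aderiv d φ (dSharp d + 1) s := by
  obtain ⟨R, _, hR⟩ := exists_support_bound hφ
  refine ⟨integrableOn_periodization (radial_eq_zero hR) hi, contDiffOn_A hd hφ hi, ?_⟩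
  intro r hr x hx
  have ha := hasDerivAt_Aext hd hφ hi
  have hc : ∀ i, Continuous (Aext d φ i) := fun i =>
    continuous_iff_continuousAt.mpr fun s => (ha i s).continuousAt
  have hL : 0 ≤ r ^ 2 := sq_nonneg r
  set L := r ^ 2
  set k := dSharp d
  have hsub : uIcc 0 L ⊆ Ici 0 := by rw [uIcc_of_le hL]; exact Icc_subset_Ici_self
  have hcongr : ∀ m : Fin d → ℤ, ∀ s ∈ uIcc 0 L, Dint k s (x - latt m) * Aext d φ (k + 1) s =
      Dint k s (x - latt m) * Aderiv d φ (k + 1) s := fun m s hs => by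
    rw [Aderiv_eq_Aext hd hφ hi _ (hsub hs)]
  have hsum := (hasSum_integral_Dint_mul hd ha (lt_half_add_dSharp hd) hL hx).congr_fun
    fun m => (intervalIntegral.integral_congr (hcongr m.1)).symm
  refine ⟨fun m => ?_, hsum.summable, ?_⟩
  · refine ContinuousOn.intervalIntegrable (ContinuousOn.congr (f := fun s =>
      Dint k s (x - latt m) * Aext d φ (k + 1) s) ?_ fun s hs => (hcongr m s hs).symm)
    exact ((continuousOn_Dint hd k _).mono hsub).mul (hc _).continuousOn
  · have hk1 : k + 1 ≠ 0 := Nat.succ_ne_zero k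
    rw [hsum.tsum_eq, sphericalSum_eq hd hφ hi hr, sphericalIntegral_eq hd hi hr,
      sum_lattice_taylor ha hk1 hL, integral_ball_taylor ha hk1 hL]
    have h1 : ∀ j, Aderiv d φ j L = Aext d φ j L := fun j => Aderiv_eq_Aext hd hφ hi j hL
    obtain ⟨hc1, hc2⟩ := continuousOn_Dsum_and_Dint hd hk1 x L
    rw [← uIcc_of_le hL] at hc1 hc2
    have h2 : ∫ s in (0 : ℝ)..L, Delta (k + 1 : ℕ) s x * Aext d φ (k + 2) s =
        (∫ s in (0 : ℝ)..L, Dsum (k + 1 : ℕ) s x * Aext d φ (k + 1 + 1) s)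
        - ∫ s in (0 : ℝ)..L, Dint (k + 1 : ℕ) s x * Aext d φ (k + 1 + 1) s := by
      rw [← intervalIntegral.integral_sub
        (f := fun s => Dsum (k + 1 : ℕ) s x * Aext d φ (k + 1 + 1) s)
        (g := fun s => Dint (k + 1 : ℕ) s x * Aext d φ (k + 1 + 1) s)
        (hc1.mul (hc (k + 1 + 1)).continuousOn).intervalIntegrable
        (hc2.mul (hc (k + 1 + 1)).continuousOn).intervalIntegrable]
      refine intervalIntegral.integral_congr fun s _ => ?_
      simp only [Delta]
      ring
    rw [h2]
    simp only [h1, Delta]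
    -- Split off the Taylor terms `j = k + 1`: with sign `(-1)^{k+1}` they match the boundary term
    -- in the sum over `m`, and the two remainder integrals match as well.
    rw [Finset.sum_range_succ, Finset.sum_range_succ _ (k + 1)]
    simp only [mul_sub, sub_mul, Finset.sum_sub_distrib]
    ring

/-! ### The functions `(a² - |x|²)^β`. -/

theorem hasCompactSupport_phiBeta (β a : ℝ) : HasCompactSupport (phiBeta β a) := by
  refine HasCompactSupport.of_support_subset_isCompact (isCompact_Icc (a := 0) (b := a.toNNReal)) ?_
  intro t ht
  refine ⟨zero_le, ?_⟩
  by_contra h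
  refine ht ?_
  rw [phiBeta, if_neg]
  intro h3
  exact h (NNReal.le_toNNReal_of_coe_le h3.le)

/-- Radially, `(a² - t²)^β = (a + t)^β (a - t)^β`. The first factor is continuous on `[0,a]`, and
the second is integrable at `a` because `β > -1`. -/
theorem integrable_U {d : ℕ} (hd : 1 ≤ d) {β a : ℝ} (hβ : -1 < β) (ha : 0 < a) :
    Integrable (U d β a) := by
  have := nontrivial_E hd
  have h := (integrableOn_fun_norm_addHaar (volume : Measure (E d)) (r := a)
    (f := fun t : ℝ => (((a ^ 2 - t ^ 2) ^ β : ℝ) : ℂ))).mpr ?_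
  · rw [← integrable_indicator_iff measurableSet_ball] at h
    refine h.congr (.of_forall fun x => ?_)
    simp [indicator, U]
  · have h1 : IntegrableOn (fun t : ℝ => (a - t) ^ β) (Icc 0 a) := by
      have h2 := (intervalIntegral.intervalIntegrable_rpow' (a := 0) (b := a) hβ).comp_sub_left a
      simp only [sub_zero, sub_self] at h2
      rw [integrableOn_Icc_iff_integrableOn_Ioc]
      exact h2.symm.1
    have hcont : ContinuousOn (fun t : ℝ => t ^ (d - 1) * (a + t) ^ β) (Icc 0 a) :=
      (continuousOn_pow _).mul ((by fun_prop : ContinuousOn (fun t : ℝ => a + t) _).rpow_const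
        fun t ht => Or.inl (by linarith [ht.1] : (0 : ℝ) < a + t).ne')
    have h3 := ((h1.continuousOn_mul hcont isCompact_Icc).mono_set Ioo_subset_Icc_self).ofReal
      (𝕜 := ℂ)
    refine h3.congr ?_
    filter_upwards [ae_restrict_mem measurableSet_Ioo] with t ht
    have e1 : (a ^ 2 - t ^ 2) ^ β = (a + t) ^ β * (a - t) ^ β := by
      rw [← Real.mul_rpow (by linarith [ht.1]) (by linarith [ht.2])]
      congr 1; ring
    rw [e1, Complex.real_smul]
    simp
    ring

end LatticeFourier

end

theorem theorem2p1 (d : ℕ) (hd : 1 ≤ d) :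
    (∀ φ : ℝ≥0 → ℂ, HasCompactSupport φ → Integrable (radial d φ) →
      IntegrableOn (periodization (radial d φ)) (torus d) ∧
      ContDiffOn ℝ ∞ (A d φ) (Ici 0) ∧
      ∀ r : ℝ, 0 ≤ r → ∀ x ∈ torus d,
        (∀ m : Fin d → ℤ, IntervalIntegrable
          (fun s => Dint (dSharp d) s (x - latt m) * Aderiv d φ (dSharp d + 1) s)
          volume 0 (r ^ 2)) ∧
        Summable (fun m : {m : Fin d → ℤ // m ≠ 0} =>
          ∫ s in (0 : ℝ)..r ^ 2,
            Dint (dSharp d) s (x - latt m.1) * Aderiv d φ (dSharp d + 1) s) ∧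
        sphericalSum r (periodization (radial d φ)) x =
          sphericalIntegral r (radial d φ) x
          + ∑ j ∈ Finset.range (dSharp d + 1),
              (-1) ^ j * Delta j (r ^ 2) x * Aderiv d φ j (r ^ 2)
          + (-1) ^ (dSharp d + 1) * ∑' m : {m : Fin d → ℤ // m ≠ 0},
              ∫ s in (0 : ℝ)..r ^ 2,
                Dint (dSharp d) s (x - latt m.1) * Aderiv d φ (dSharp d + 1) s) ∧
    (∀ β a : ℝ, -1 < β → 0 < a →
      Integrable (U d β a) ∧
      IntegrableOn (u d β a) (torus d) ∧
      ContDiffOn ℝ ∞ (A d (phiBeta β a)) (Ici 0) ∧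
      ∀ r : ℝ, 0 ≤ r → ∀ x ∈ torus d,
        (∀ m : Fin d → ℤ, IntervalIntegrable
          (fun s => Dint (dSharp d) s (x - latt m) * Aderiv d (phiBeta β a) (dSharp d + 1) s)
          volume 0 (r ^ 2)) ∧
        Summable (fun m : {m : Fin d → ℤ // m ≠ 0} =>
          ∫ s in (0 : ℝ)..r ^ 2,
            Dint (dSharp d) s (x - latt m.1) * Aderiv d (phiBeta β a) (dSharp d + 1) s) ∧
        sphericalSum r (u d β a) x =
          sphericalIntegral r (U d β a) x
          + ∑ j ∈ Finset.range (dSharp d + 1),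
              (-1) ^ j * Delta j (r ^ 2) x * Aderiv d (phiBeta β a) j (r ^ 2)
          + (-1) ^ (dSharp d + 1) * ∑' m : {m : Fin d → ℤ // m ≠ 0},
              ∫ s in (0 : ℝ)..r ^ 2,
                Dint (dSharp d) s (x - latt m.1) *
                  Aderiv d (phiBeta β a) (dSharp d + 1) s) := by
  refine ⟨fun φ hφ hi => radial_expansion hd hφ hi, fun β a hβ ha => ?_⟩
  have hi := integrable_U hd hβ ha
  -- `U d β a` and `radial d (phiBeta β a)` agree definitionally, so the general expansion applies
  -- as it stands.
  exact ⟨hi, radial_expansion hd (hasCompactSupport_phiBeta β a) hi⟩
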